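/- Let $\Omega\subset\mathbb R^3$ be open, bounded and simply connected, with boundary $\Gamma$ of finite surface area and outward unit normal $n$. Write $X=L^2(\Omega;\mathbb R^3)$ and $\mathcal H=\{v\in H^1_0(\Omega):\nabla v\in H(\operatorname{div};\Omega),\ \partial_n v\in L^2(\Gamma)\}$ with norm $\|v\|_{\mathcal H}=(\|v\|_{H^1}^2+\|\Delta v\|_{L^2(\Omega)}^2+\|\partial_n v\|_{L^2(\Gamma)}^2)^{1/2}$. Assume that for every $g\in L^2(\Omega)$ there is a unique $w\in\mathcal H$ with $\int_\Omega\nabla w\cdot\nabla v\,dx=\int_\Omega g v\,dx$ for all $v\in H_0^1(\Omega)$, and that $\|w\|_{\mathcal H}\le C\|g\|_{L^2(\Omega)}$ with $C$ independent of $g$ and $w$. Then for every $u\in L^2(\Gamma)$ there is a unique $\eta_u\in L^2(\Omega)$ (the very weak solution of $-\Delta\eta=0$ in $\Omega$, $\eta=u$ on $\Gamma$) with $-\int_\Omega \eta_u\Delta v\,dx+\int_\Gamma u\,\partial_n v\,d\varsigma=0$ for all $v\in\mathcal H$. Let $T,c,m_0,q,\alpha>0$, $R\in\mathbb R$, $p_0\in\mathbb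 R^3$, $E_0,B_0\in X$. Let $\varphi\in C^{2,1}(\mathbb R^3)$ be nonnegative and rotationally symmetric with $\int\varphi=1$ and support in the ball of radius $R$ about $0$. Let $J_1,J_2\in C^1(\mathbb R^3)$ be bounded from below, and let $g_1,\dots,g_m\in C^1(\mathbb R^3)$ be such that $\tilde\Omega=\{x\in\mathbb R^3: g_i(x)\le 0,\ i=1,\dots,m\}$ satisfies $\tilde\Omega\subset\Omega$ and $\operatorname{dist}(\tilde\Omega,\Gamma)>R$. Let $r_0\in\tilde\Omega$. For $p\in\mathbb R^3$ put $v(p)=\dfrac{p}{m_0\sqrt{1+|p|^2/(m_0c)^2}}$ and $\beta(p)=c^{-1}v(p)$. Let $\mathcal A(V_1,V_2)=(-\operatorname{curl}V_2,\operatorname{curl}V_1)$ on $X\times X$ with domain $\{V\in H(\operatorname{curl};\Omega)^2: V_1\times n=0 \text{ on }\Gamma\}$, and let $\mathcal G$ be the $C_0$-semigroup generated by $-\mathcal A$. For continuous $r,p:[0,T]\to\mathbb R^3$ let $j(r,p)(t)=(-q\,\varphi(\cdot-r(t))\,v(p(t)),0)\in X\times X$, let $$(E,B)(t)=\mathcal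 G(t)(E_0,B_0)+\int_0^t\mathcal G(t-\tau)\,j(r,p)(\tau)\,d\tau$$ be the corresponding mild solution of Maxwell's equations, and let $F_L(r,p)(t)=E(t)+\beta(p(t))\times B(t)$. Consider the problem (P): minimize $$\mathcal J(w+r_0,u)=\int_0^T J_1(w(t)+r_0)\,dt+J_2(w(T)+r_0)+\frac{\alpha}{2}\int_\Gamma u^2\,d\varsigma$$ over all $u\in L^2(\Gamma)$ and $w,z\in C^1([0,T];\mathbb R^3)$ with $w(0)=z(0)=0$ such that, for all $t\in[0,T]$, the state equations $$\dot w(t)=v(z(t)+p_0),$$ $$\begin{aligned}\dot z(t)={}&q\int_\Omega\varphi(x-w(t)-r_0)\,F_L(w+r_0,z+p_0)(t)\,dx\\&-q\int_\Omega\eta_u\,\nabla\varphi(x-w(t)-r_0)\times\beta(z(t)+p_0)\,dx+q\int_\Gamma u\,\varphi(x-w(t)-r_0)\,\beta(z(t)+p_0)\times n\,d\varsigma\end{aligned}$$ and the state constraints $g_i(w(t)+r_0)\le0$, $i=1,\dots,m$, hold. If there is a control $u\in L^2(\Gamma)$ with an associated state $(w,z)$ (a solution of the state equations) satisfying the state constraints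 for all $t\in[0,T]$, then (P) has at least one globally optimal control: there is a feasible triple $(w^*,z^*,u^*)$ with $\mathcal J(w^*+r_0,u^*)\le\mathcal J(w+r_0,u)$ for all feasible $(w,z,u)$. -/

import Mathlib

open MeasureTheory Filter Topology Set
open scoped ContDiff

noncomputable section

namespace AbrahamControl

/-- Three-dimensional Euclidean space. -/
abbrev E3 : Type := EuclideanSpace ℝ (Fin 3)

/-- The vector product on `E3`. -/
def cross (a b : E3) : E3 := WithLp.toLp 2 (crossProduct a.ofLp b.ofLp)

/-- `partialAt i F x j` is the partial derivative `∂_i F_j` at `x`. -/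
def partialAt (i : Fin 3) (F : E3 → E3) (x : E3) (j : Fin 3) : ℝ :=
  fderiv ℝ F x (EuclideanSpace.single i 1) j

/-- The classical curl of a differentiable vector field. -/
def curl (F : E3 → E3) (x : E3) : E3 :=
  !₂[partialAt 1 F x 2 - partialAt 2 F x 1,
     partialAt 2 F x 0 - partialAt 0 F x 2,
     partialAt 0 F x 1 - partialAt 1 F x 0]

/-! ### Function spaces on `Ω` and on its boundary -/

/-- `L²(Ω)`. -/
abbrev L2 (Ω : Set E3) : Type := Lp ℝ 2 (volume.restrict Ω)

/-- `X = L²(Ω; ℝ³)`. -/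
abbrev X (Ω : Set E3) : Type := Lp E3 2 (volume.restrict Ω)

/-- Surface measure on `Γ = ∂Ω`: the two-dimensional Hausdorff measure, normalized so that it
agrees with Lebesgue measure on planes, restricted to the boundary. -/
def surface (Ω : Set E3) : Measure E3 :=
  (Measure.euclideanHausdorffMeasure 2 : Measure E3).restrict (frontier Ω)

/-- `L²(Γ)`. -/
abbrev L2Bdry (Ω : Set E3) : Type := Lp ℝ 2 (surface Ω)

/-- The class in `X` of a square integrable vector field (and `0` for other fields). -/
def toX (Ω : Set E3) (f : E3 → E3) : X Ω :=
  open Classical in if h : MemLp f 2 (volume.restrict Ω) then h.toLp f else 0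

/-- `ν` is an outward unit normal of `Ω` at `x`: near `x`, every open cone around `-ν` of opening
less than a right angle lies in `Ω`, and every such cone around `ν` lies outside `Ω`. -/
def IsOutwardNormal (Ω : Set E3) (x ν : E3) : Prop :=
  ‖ν‖ = 1 ∧ ∀ δ > 0, ∃ ρ > 0, ∀ y ∈ Metric.ball x ρ,
    (inner ℝ (y - x) ν < -(δ * ‖y - x‖) → y ∈ Ω) ∧
    (δ * ‖y - x‖ < inner ℝ (y - x) ν → y ∉ Ω)

/-- The outward unit normal field `n` on `Γ` (with value `0` at points without a normal). -/
def normal (Ω : Set E3) (x : E3) : E3 :=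
  open Classical in if h : ∃ ν, IsOutwardNormal Ω x ν then h.choose else 0

/-- `ψ ∈ C_c^∞(U; F)`. -/
def IsTest {F : Type} [NormedAddCommGroup F] [NormedSpace ℝ F] (U : Set E3) (ψ : E3 → F) : Prop :=
  ContDiff ℝ ∞ ψ ∧ HasCompactSupport ψ ∧ tsupport ψ ⊆ U

/-- `f ∈ H(curl; Ω)` with distributional curl `c`. -/
def HasCurl (Ω : Set E3) (f c : X Ω) : Prop :=
  ∀ ψ : E3 → E3, IsTest Ω ψ →
    ∫ x in Ω, inner ℝ (f x) (curl ψ x) = ∫ x in Ω, inner ℝ (c x) (ψ x)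

/-- `f ∈ H(curl; Ω)` with curl `c` and vanishing tangential trace `f × n = 0` on `Γ`, that is,
`(f, c)` belongs to the closure of the graph of `curl` on `C_c^∞(Ω; ℝ³)`. -/
def HasCurlZeroTrace (Ω : Set E3) (f c : X Ω) : Prop :=
  (f, c) ∈ closure {a : X Ω × X Ω | ∃ ψ : E3 → E3, IsTest Ω ψ ∧
    a.1 =ᵐ[volume.restrict Ω] ψ ∧ a.2 =ᵐ[volume.restrict Ω] curl ψ}

/-- `v ∈ H¹₀(Ω)` with weak gradient `Dv`: closure of `C_c^∞(Ω)` with respect to the `H¹` norm. -/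
def MemH10 (Ω : Set E3) (v : L2 Ω) (Dv : X Ω) : Prop :=
  (v, Dv) ∈ closure {a : L2 Ω × X Ω | ∃ ψ : E3 → ℝ, IsTest Ω ψ ∧
    a.1 =ᵐ[volume.restrict Ω] ψ ∧ a.2 =ᵐ[volume.restrict Ω] gradient ψ}

/-- `f ∈ H(div; Ω)` with distributional divergence `d`. -/
def HasDiv (Ω : Set E3) (f : X Ω) (d : L2 Ω) : Prop :=
  ∀ ψ : E3 → ℝ, IsTest Ω ψ →
    ∫ x in Ω, inner ℝ (f x) (gradient ψ x) = -∫ x in Ω, d x * ψ x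

/-- The normal trace `f · n` of a field `f ∈ H(div; Ω)` with divergence `d` is the function
`h ∈ L²(Γ)`; the normal trace is defined by Green's formula. -/
def HasNormalTrace (Ω : Set E3) (f : X Ω) (d : L2 Ω) (h : L2Bdry Ω) : Prop :=
  ∀ ψ : E3 → ℝ, IsTest univ ψ →
    ∫ x, h x * ψ x ∂(surface Ω) =
      (∫ x in Ω, inner ℝ (f x) (gradient ψ x)) + ∫ x in Ω, d x * ψ x

/-- `v` belongs to `𝓗 = {v ∈ H¹₀(Ω) : ∇v ∈ H(div; Ω), ∂ₙv ∈ L²(Γ)}`, with gradient `Dv`,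
Laplacian `Lv = div ∇v` and normal derivative `dn = ∂ₙv`. -/
def MemH (Ω : Set E3) (v : L2 Ω) (Dv : X Ω) (Lv : L2 Ω) (dn : L2Bdry Ω) : Prop :=
  MemH10 Ω v Dv ∧ HasDiv Ω Dv Lv ∧ HasNormalTrace Ω Dv Lv dn

/-- `∫_Ω ∇w · ∇v = ∫_Ω g v` for all `v ∈ H¹₀(Ω)`, where `Dw = ∇w`. -/
def SolvesWeakPoisson (Ω : Set E3) (g : L2 Ω) (Dw : X Ω) : Prop :=
  ∀ (v : L2 Ω) (Dv : X Ω), MemH10 Ω v Dv →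
    ∫ x in Ω, inner ℝ (Dw x) (Dv x) = ∫ x in Ω, g x * v x

/-- For every `g ∈ L²(Ω)` the weak Poisson equation has a unique solution `w ∈ 𝓗`, and
`‖w‖_𝓗 ≤ C ‖g‖` with `C` independent of `g` and `w`. -/
def PoissonRegular (Ω : Set E3) : Prop :=
  (∀ g : L2 Ω, ∃! w : L2 Ω, ∃ (Dw : X Ω) (Lw : L2 Ω) (dn : L2Bdry Ω),
    MemH Ω w Dw Lw dn ∧ SolvesWeakPoisson Ω g Dw) ∧
  ∃ C > 0, ∀ (g w : L2 Ω) (Dw : X Ω) (Lw : L2 Ω) (dn : L2Bdry Ω),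
    MemH Ω w Dw Lw dn → SolvesWeakPoisson Ω g Dw →
      Real.sqrt ((‖w‖ ^ 2 + ‖Dw‖ ^ 2) + ‖Lw‖ ^ 2 + ‖dn‖ ^ 2) ≤ C * ‖g‖

/-! ### Very weak solutions of Laplace's equation with Dirichlet data in `L²(Γ)` -/

/-- `η ∈ L²(Ω)` is a very weak solution of `-Δη = 0` in `Ω`, `η = u` on `Γ`. -/
def IsVeryWeakSolution (Ω : Set E3) (u : L2Bdry Ω) (η : L2 Ω) : Prop :=
  ∀ (v : L2 Ω) (Dv : X Ω) (Lv : L2 Ω) (dn : L2Bdry Ω), MemH Ω v Dv Lv dn →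
    -(∫ x in Ω, η x * Lv x) + ∫ x, u x * dn x ∂(surface Ω) = 0

/-- The very weak solution with Dirichlet data `u`; it exists and is unique when `PoissonRegular`
holds. -/
def potential (Ω : Set E3) (u : L2Bdry Ω) : L2 Ω :=
  open Classical in if h : ∃ η, IsVeryWeakSolution Ω u η then h.choose else 0

/-! ### The Maxwell semigroup -/

/-- `V` lies in the domain of the Maxwell operator `𝓐 (V₁, V₂) = (-curl V₂, curl V₁)`,
`D(𝓐) = {V ∈ H(curl; Ω)² : V₁ × n = 0}`, and `𝓐 V = W`. -/
def MaxwellOp (Ω : Set E3) (V W : X Ω × X Ω) : Prop :=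
  HasCurlZeroTrace Ω V.1 W.2 ∧ HasCurl Ω V.2 (-W.1)

/-- `G`, restricted to `[0, ∞)`, is a strongly continuous semigroup of bounded operators. -/
structure IsC0Semigroup {H : Type} [NormedAddCommGroup H] [NormedSpace ℝ H]
    (G : ℝ → H →L[ℝ] H) : Prop where
  zero : G 0 = ContinuousLinearMap.id ℝ H
  add : ∀ s t, 0 ≤ s → 0 ≤ t → G (s + t) = (G s).comp (G t)
  cont : ∀ V, ContinuousOn (fun t => G t V) (Ici 0)

/-- The infinitesimal generator of `G` is the operator with graph `A`. -/
def HasGenerator {H : Type} [NormedAddCommGroup H] [NormedSpace ℝ H]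
    (G : ℝ → H →L[ℝ] H) (A : H → H → Prop) : Prop :=
  ∀ V W, A V W ↔ Tendsto (fun h : ℝ => h⁻¹ • (G h V - V)) (𝓝[>] 0) (𝓝 W)

/-- `G` is the semigroup solving `∂ₜ V + 𝓐 V = 0`, that is, the one generated by `-𝓐`. -/
def IsMaxwellSemigroup (Ω : Set E3) (G : ℝ → (X Ω × X Ω) →L[ℝ] (X Ω × X Ω)) : Prop :=
  IsC0Semigroup G ∧ HasGenerator G (fun V W => MaxwellOp Ω V (-W))

/-- The Maxwell semigroup `𝓖`. As `𝓐` is skew-adjoint for every open `Ω`, the semigroup exists; its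
operators for nonnegative times are determined by the generator. -/
def maxwellSemigroup (Ω : Set E3) : ℝ → (X Ω × X Ω) →L[ℝ] (X Ω × X Ω) :=
  open Classical in if h : ∃ G, IsMaxwellSemigroup Ω G then h.choose else 0

/-! ### The optimal control problem -/

/-- The data of the optimal control problem. -/
structure ProblemData where
  /-- the interior of the accelerator -/
  Ω : Set E3
  /-- final time -/
  T : ℝ
  /-- speed of light -/
  c : ℝ
  /-- rest mass of the particle -/
  m₀ : ℝ
  /-- charge of the particle -/
  q : ℝ
  /-- radius of the smeared out point charge -/
  R : ℝ
  /-- Tikhonov parameter -/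
  α : ℝ
  /-- smeared out delta distribution -/
  φ : E3 → ℝ
  /-- initial position -/
  r₀ : E3
  /-- initial momentum -/
  p₀ : E3
  /-- initial electric field -/
  E₀ : X Ω
  /-- initial magnetic field -/
  B₀ : X Ω
  /-- running cost -/
  J₁ : E3 → ℝ
  /-- terminal cost -/
  J₂ : E3 → ℝ
  /-- number of state constraints -/
  m : ℕ
  /-- state constraint functions -/
  g : Fin m → E3 → ℝ

namespace ProblemData

variable (P : ProblemData)

/-- `Ω̃ = {x : g_i(x) ≤ 0, i = 1, …, m}`. -/
def admissible : Set E3 := {x | ∀ i, P.g i x ≤ 0}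

/-- The standing assumptions on the data. -/
structure StandingAssumptions : Prop where
  isOpen : IsOpen P.Ω
  isBounded : Bornology.IsBounded P.Ω
  simplyConnected : IsSimplyConnected P.Ω
  surface_finite : surface P.Ω univ < ⊤
  poissonRegular : PoissonRegular P.Ω
  T_pos : 0 < P.T
  c_pos : 0 < P.c
  m₀_pos : 0 < P.m₀
  q_pos : 0 < P.q
  α_pos : 0 < P.α
  φ_contDiff : ContDiff ℝ 2 P.φ
  φ_lipschitz : ∃ K, LipschitzWith K (iteratedFDeriv ℝ 2 P.φ)
  φ_support : tsupport P.φ ⊆ Metric.closedBall 0 P.R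
  φ_nonneg : ∀ x, 0 ≤ P.φ x
  φ_integral : ∫ x, P.φ x = 1
  φ_radial : ∀ x y, ‖x‖ = ‖y‖ → P.φ x = P.φ y
  g_contDiff : ∀ i, ContDiff ℝ 1 (P.g i)
  admissible_subset : P.admissible ⊆ P.Ω
  /-- `dist(Ω̃, Γ) > R`; both sets are compact and nonempty, so the distance is attained. -/
  admissible_dist : ∀ x ∈ P.admissible, ∀ y ∈ frontier P.Ω, P.R < dist x y
  r₀_mem : P.r₀ ∈ P.admissible
  J₁_contDiff : ContDiff ℝ 1 P.J₁
  J₂_contDiff : ContDiff ℝ 1 P.J₂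
  J₁_bddBelow : ∃ c₁ : ℝ, ∀ x, c₁ ≤ P.J₁ x
  J₂_bddBelow : ∃ c₂ : ℝ, ∀ x, c₂ ≤ P.J₂ x

/-- The Lorentz factor. -/
def γ (p : E3) : ℝ := Real.sqrt (1 + ‖p‖ ^ 2 / (P.m₀ * P.c) ^ 2)

/-- The velocity of a particle with momentum `p`. -/
def v (p : E3) : E3 := (P.m₀ * P.γ p)⁻¹ • p

/-- `β(p) = v(p) / c`. -/
def β (p : E3) : E3 := P.c⁻¹ • P.v p

/-- The current density `j(r, p)(t) = (-q φ(· - r(t)) v(p(t)), 0) ∈ X × X`. -/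
def current (r p : ℝ → E3) (t : ℝ) : X P.Ω × X P.Ω :=
  (toX P.Ω (fun x => -(P.q * P.φ (x - r t)) • P.v (p t)), 0)

/-- The mild solution `(E(t), B(t))` of Maxwell's equations with current `j(r, p)`. -/
def field (r p : ℝ → E3) (t : ℝ) : X P.Ω × X P.Ω :=
  maxwellSemigroup P.Ω t (P.E₀, P.B₀) +
    ∫ τ in (0 : ℝ)..t, maxwellSemigroup P.Ω (t - τ) (P.current r p τ)

/-- The Lorentz force `F_L(r, p)(x, t) = E(x, t) + β(p(t)) × B(x, t)`. -/
def lorentz (r p : ℝ → E3) (t : ℝ) (x : E3) : E3 :=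
  (P.field r p t).1 x + cross (P.β (p t)) ((P.field r p t).2 x)

/-- First component of the state system operator (momentum equation). -/
def e₁ (w z : ℝ → E3) (u : L2Bdry P.Ω) (t : ℝ) : E3 :=
  derivWithin z (Icc 0 P.T) t
    - P.q • (∫ x in P.Ω, P.φ (x - w t - P.r₀) •
        P.lorentz (fun s => w s + P.r₀) (fun s => z s + P.p₀) t x)
    + P.q • (∫ x in P.Ω, potential P.Ω u x •
        cross (gradient P.φ (x - w t - P.r₀)) (P.β (z t + P.p₀)))
    - P.q • (∫ x, (u x * P.φ (x - w t - P.r₀)) •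
        cross (P.β (z t + P.p₀)) (normal P.Ω x) ∂(surface P.Ω))

/-- Second component of the state system operator (velocity equation). -/
def e₂ (w z : ℝ → E3) (t : ℝ) : E3 :=
  derivWithin w (Icc 0 P.T) t - P.v (z t + P.p₀)

/-- `w ∈ C¹([0, T]; ℝ³)` with `w(0) = 0`. -/
def MemC10 (w : ℝ → E3) : Prop := ContDiffOn ℝ 1 w (Icc 0 P.T) ∧ w 0 = 0

/-- `(w, z, u)` is a solution of the state system, so that `(w, z)` is the state associated with
the control `u`. -/
def IsState (w z : ℝ → E3) (u : L2Bdry P.Ω) : Prop :=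
  P.MemC10 w ∧ P.MemC10 z ∧ ∀ t ∈ Icc 0 P.T, P.e₁ w z u t = 0 ∧ P.e₂ w z t = 0

/-- The state constraint `g_i(w(t) + r₀) ≤ 0` for all `i` and all `t ∈ [0, T]`. -/
def StateConstraint (w : ℝ → E3) : Prop :=
  ∀ i, ∀ t ∈ Icc 0 P.T, P.g i (w t + P.r₀) ≤ 0

/-- The objective `∫₀ᵀ J₁(r(t)) dt + J₂(r(T)) + α/2 ∫_Γ u²`. -/
def objective (r : ℝ → E3) (u : L2Bdry P.Ω) : ℝ :=
  (∫ t in (0 : ℝ)..P.T, P.J₁ (r t)) + P.J₂ (r P.T)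
    + P.α / 2 * ∫ x, u x ^ 2 ∂(surface P.Ω)

/-- `(w, z, u)` is feasible for the optimal control problem. -/
def Feasible (w z : ℝ → E3) (u : L2Bdry P.Ω) : Prop :=
  P.IsState w z u ∧ P.StateConstraint w

/-- `u` is a globally optimal control: with a state of `u` it is feasible, and no feasible triple
has a smaller objective value. -/
def IsOptimalControl (u : L2Bdry P.Ω) : Prop :=
  ∃ w z : ℝ → E3, P.Feasible w z u ∧
    ∀ (w' z' : ℝ → E3) (u' : L2Bdry P.Ω), P.Feasible w' z' u' →
      P.objective (fun t => w t + P.r₀) u ≤ P.objective (fun t => w' t + P.r₀) u'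

end ProblemData

end AbrahamControl

end

/-! The proof is the direct method of the calculus of variations, carried out on triples (state,
control), so uniqueness of the state is never needed.

Since `J₁` and `J₂` are bounded below and `α > 0`, the controls of a minimizing sequence are bounded
in the separable Hilbert space L²(Γ), and a subsequence converges weakly. The state constraint keeps
the particle farther than `R` from Γ, so the boundary integral in the momentum equation vanishes and
the control acts only through its potential `η_u`. If `S` maps a Poisson right-hand side `g` to the
normal derivative of its solution, then Δw = -g turns the very weak formulation into `η_u = -S* u`
(`exists_potential_operator`). Thus `u ↦ η_u` is bounded and linear, hence weakly continuous.

Velocities are bounded by `c`. Forces are bounded uniformly: the semigroup is bounded on `[0, T]`,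
the currents are bounded in X, and the potentials are bounded. Therefore the states are
equi-Lipschitz, and Arzelà–Ascoli gives pointwise convergence along a further subsequence.

To pass to the limit in the force, each component is written as an inner product of a field or
potential with a kernel built from φ or ∇φ (`inner_force`). The kernels converge strongly in L²,
which suffices against fields converging strongly and potentials converging only weakly
(`tendsto_force`). Integrating the equations in time and using dominated convergence shows that the
limit is a C¹ solution (`contDiffOn_of_tendsto_derivWithin`). The constraints are closed conditions,
and the objective is lower semicontinuous because the squared norm is weakly so. -/

namespace AbrahamControl

/-! ### Weak convergence in Hilbert spaces -/

/-- A bounded sequence in a separable real Hilbert space has a weakly convergent subsequence. -/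
theorem exists_weakly_convergent_subseq {H : Type*} [NormedAddCommGroup H] [InnerProductSpace ℝ H]
    [CompleteSpace H] [TopologicalSpace.SeparableSpace H] (u : ℕ → H) (C : ℝ)
    (hu : ∀ n, ‖u n‖ ≤ C) :
    ∃ (a : H) (k : ℕ → ℕ), StrictMono k ∧
      ∀ y, Tendsto (fun n => inner ℝ (u (k n)) y) atTop (𝓝 (inner ℝ a y)) := by
  -- Sequential Banach–Alaoglu in the dual, transported through the Riesz isomorphism.
  obtain ⟨l, -, k, hk, hl⟩ := WeakDual.isSeqCompact_closedBall ℝ H 0 C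
    (x := fun n => StrongDual.toWeakDual (InnerProductSpace.toDual ℝ H (u n)))
    (fun n => by simpa using hu n)
  refine ⟨(InnerProductSpace.toDual ℝ H).symm (WeakDual.toStrongDual l), k, hk, fun y => ?_⟩
  have := ((WeakDual.eval_continuous y).tendsto l).comp hl
  simpa [Function.comp_def] using this

/-- The inner product of a bounded weakly convergent sequence with a strongly convergent one
converges. -/
theorem tendsto_inner_of_weak_of_strong {H : Type*} [NormedAddCommGroup H]
    [InnerProductSpace ℝ H] {u : ℕ → H} {a : H} {C : ℝ} (hu : ∀ n, ‖u n‖ ≤ C)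
    (hw : ∀ y, Tendsto (fun n => inner ℝ (u n) y) atTop (𝓝 (inner ℝ a y)))
    {y : ℕ → H} {b : H} (hy : Tendsto y atTop (𝓝 b)) :
    Tendsto (fun n => inner ℝ (u n) (y n)) atTop (𝓝 (inner ℝ a b)) := by
  -- Split `y n = (y n - b) + b`: boundedness of `u` handles the first part, weak convergence the
  -- second.
  have h0 : Tendsto (fun n => inner ℝ (u n) (y n - b)) atTop (𝓝 0) := by
    have h1 : Tendsto (fun n => C * ‖y n - b‖) atTop (𝓝 0) := by
      simpa using (tendsto_iff_norm_sub_tendsto_zero.1 hy).const_mul C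
    refine squeeze_zero_norm (fun n => ?_) h1
    exact (norm_inner_le_norm _ _).trans (mul_le_mul_of_nonneg_right (hu n) (norm_nonneg _))
  have := h0.add (hw b)
  simpa [inner_sub_right] using this

/-! ### Compactness of bounded sets of Lipschitz curves -/

/-- A uniformly Lipschitz sequence of curves starting at `0` has a subsequence converging pointwise
to a continuous curve. -/
theorem exists_convergent_subseq_of_lipschitzOn {V : Type*} [NormedAddCommGroup V] [ProperSpace V]
    {T : ℝ} (hT : 0 ≤ T) (f : ℕ → ℝ → V) (K : NNReal)
    (hf : ∀ n, LipschitzOnWith K (f n) (Icc 0 T)) (h0 : ∀ n, f n 0 = 0) :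
    ∃ (g : ℝ → V) (k : ℕ → ℕ), Continuous g ∧ StrictMono k ∧
      ∀ t ∈ Icc 0 T, Tendsto (fun n => f (k n) t) atTop (𝓝 (g t)) := by
  let F : ℕ → BoundedContinuousFunction (Icc 0 T) V := fun n =>
    BoundedContinuousFunction.mkOfCompact
      ⟨(Icc 0 T).domRestrict (f n), (hf n).continuousOn.domRestrict⟩
  have hF : ∀ n, LipschitzWith K (F n) := fun n => (hf n).to_restrict
  have hcomp : IsCompact (closure (range F)) := by
    -- All curves start at 0 and have Lipschitz constant `K`, so their values stay in the compact
    -- ball of radius `K * T`.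
    refine BoundedContinuousFunction.arzela_ascoli (Metric.closedBall 0 (K * T))
      (isCompact_closedBall _ _) _ ?_ ?_
    · rintro _ x ⟨n, rfl⟩
      have h := (hf n).dist_le_mul x x.2 0 ⟨le_rfl, hT⟩
      rw [h0] at h
      refine h.trans (mul_le_mul_of_nonneg_left ?_ K.2)
      rw [Real.dist_eq, sub_zero, abs_of_nonneg x.2.1]
      exact x.2.2
    · refine (LipschitzWith.uniformEquicontinuous _ K ?_).equicontinuous
      rintro ⟨_, n, rfl⟩
      exact hF n
  obtain ⟨G, -, k, hk, hG⟩ := hcomp.tendsto_subseq (fun n => subset_closure (mem_range_self n))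
  refine ⟨IccExtend hT G, k, G.continuous.Icc_extend', hk, fun t ht => ?_⟩
  rw [IccExtend_of_mem hT G ht]
  exact (BoundedContinuousFunction.tendsto_iff_tendstoUniformly.1 hG).tendsto_at ⟨t, ht⟩

/-! ### Strongly continuous families of operators -/

/-- A uniformly bounded strongly continuous family of operators is jointly continuous. -/
theorem continuous_apply_of_strong {Y H : Type*} [TopologicalSpace Y] [NormedAddCommGroup H]
    [NormedSpace ℝ H] {G : Y → H →L[ℝ] H} {M : ℝ} (hM : ∀ s, ‖G s‖ ≤ M)
    (hG : ∀ V, Continuous fun s => G s V) : Continuous fun p : Y × H => G p.1 p.2 := by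
  rw [continuous_iff_continuousAt]
  rintro ⟨s, V⟩
  rw [ContinuousAt, tendsto_iff_norm_sub_tendsto_zero]
  have h1 : Tendsto (fun p : Y × H => M * ‖p.2 - V‖ + ‖G p.1 V - G s V‖) (𝓝 (s, V)) (𝓝 0) := by
    have : Continuous fun p : Y × H => M * ‖p.2 - V‖ + ‖G p.1 V - G s V‖ := by
      have := (hG V).comp (continuous_fst (X := Y) (Y := H))
      simp only [Function.comp_def] at this
      fun_prop
    simpa using this.tendsto (s, V)
  refine squeeze_zero (fun _ => norm_nonneg _) (fun p => ?_) h1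
  calc ‖G p.1 p.2 - G s V‖ = ‖G p.1 (p.2 - V) + (G p.1 V - G s V)‖ := by
        rw [map_sub]; congr 1; abel
    _ ≤ _ := (norm_add_le _ _).trans (add_le_add_left
        (((G p.1).le_opNorm _).trans (mul_le_mul_of_nonneg_right (hM _) (norm_nonneg _))) _)

/-- A strongly continuous family of operators is bounded on compact intervals. -/
theorem exists_norm_le_of_strong {H : Type*} [NormedAddCommGroup H] [NormedSpace ℝ H]
    [CompleteSpace H] {G : ℝ → H →L[ℝ] H} (hG : ∀ V, ContinuousOn (fun t => G t V) (Ici 0))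
    (T : ℝ) : ∃ M, 0 ≤ M ∧ ∀ t ∈ Icc 0 T, ‖G t‖ ≤ M := by
  obtain ⟨M, hM⟩ := banach_steinhaus (g := fun t : Icc 0 T => G t) (fun V => by
    obtain ⟨C, hC⟩ := isCompact_Icc.exists_bound_of_continuousOn
      ((hG V).mono (fun t ht => ht.1 : Icc 0 T ⊆ Ici 0))
    exact ⟨C, fun t => hC t t.2⟩)
  -- The maximum secures nonnegativity also when `T < 0` and the interval is empty.
  exact ⟨max M 0, le_max_right _ _, fun t ht => (hM ⟨t, ht⟩).trans (le_max_left _ _)⟩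

/-! ### Classes of functions in `L²` -/

section LpClass

variable {F : Type*} [NormedAddCommGroup F] {μ : Measure E3}

/-- The class in `L²(μ)` of a square integrable function (and `0` for other functions). -/
noncomputable def lpClass (μ : Measure E3) (f : E3 → F) : Lp F 2 μ :=
  open Classical in if h : MemLp f 2 μ then h.toLp f else 0

theorem coeFn_lpClass {f : E3 → F} (h : MemLp f 2 μ) : lpClass μ f =ᵐ[μ] f := by
  rw [lpClass, dif_pos h]
  exact h.coeFn_toLp

theorem lpClass_eq_of_ae {f : E3 → F} {a : Lp F 2 μ} (h : a =ᵐ[μ] f) : lpClass μ f = a := by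
  have hf : MemLp f 2 μ := (memLp_congr_ae h).1 (Lp.memLp a)
  exact Lp.ext ((coeFn_lpClass hf).trans h.symm)

theorem memLp_of_continuous_of_bound [IsFiniteMeasure μ] {f : E3 → F} (hf : Continuous f) {C : ℝ}
    (hC : ∀ x, ‖f x‖ ≤ C) : MemLp f 2 μ :=
  have := secondCountableTopologyEither_of_left E3 F
  MemLp.of_bound hf.aestronglyMeasurable C (ae_of_all _ hC)

theorem memLp_of_hasCompactSupport [IsFiniteMeasure μ] {f : E3 → F} (hf : Continuous f)
    (hs : HasCompactSupport f) : MemLp f 2 μ :=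
  let ⟨_, hC⟩ := hs.exists_bound_of_continuous hf
  memLp_of_continuous_of_bound hf hC

/-- Bounded continuous functions have bounded classes. -/
theorem exists_norm_lpClass_le (μ : Measure E3) [IsFiniteMeasure μ] :
    ∃ m : ℝ, 0 ≤ m ∧ ∀ (f : E3 → F) (C : ℝ), Continuous f → 0 ≤ C → (∀ x, ‖f x‖ ≤ C) →
      ‖lpClass μ f‖ ≤ m * C := by
  -- The constant is the square root of the total mass.
  refine ⟨measureUnivNNReal μ ^ (2 : ENNReal).toReal⁻¹, by positivity, fun f C hf h0 hC => ?_⟩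
  refine Lp.norm_le_of_ae_bound h0 ?_
  filter_upwards [coeFn_lpClass (memLp_of_continuous_of_bound (μ := μ) hf hC)] with x hx
  rw [hx]
  exact hC x

variable [InnerProductSpace ℝ F]

theorem inner_lpClass_right {f : E3 → F} (h : MemLp f 2 μ) (a : Lp F 2 μ) :
    inner ℝ a (lpClass μ f) = ∫ x, inner ℝ (a x) (f x) ∂μ := by
  rw [L2.inner_def]
  refine integral_congr_ae ?_
  filter_upwards [coeFn_lpClass h] with x hx
  rw [hx]

/-- The class of a continuous and locally uniformly bounded family of functions depends
continuously on the parameter. -/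
theorem continuous_lpClass [IsFiniteMeasure μ] {A : Type*} [TopologicalSpace A]
    [FirstCountableTopology A] {K : A → E3 → F} (hK : Continuous (Function.uncurry K))
    {b : A → ℝ} (hb : Continuous b) (hKb : ∀ a x, ‖K a x‖ ≤ b a) :
    Continuous fun a => lpClass μ (K a) := by
  have := secondCountableTopologyEither_of_left E3 F
  have hKa : ∀ a, Continuous (K a) := fun a => hK.comp (Continuous.prodMk_right a)
  have hmem : ∀ a, MemLp (K a) 2 μ := fun a => memLp_of_continuous_of_bound (hKa a) (hKb a)
  rw [continuous_iff_continuousAt]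
  intro a₀
  rw [ContinuousAt, tendsto_iff_norm_sub_tendsto_zero]
  have hsq : ∀ a, ‖lpClass μ (K a) - lpClass μ (K a₀)‖ =
      √(∫ x, ‖K a x - K a₀ x‖ ^ 2 ∂μ) := by
    intro a
    rw [eq_comm, Real.sqrt_eq_iff_eq_sq (integral_nonneg fun _ => by positivity) (norm_nonneg _),
      ← real_inner_self_eq_norm_sq, L2.inner_def]
    refine integral_congr_ae ?_
    filter_upwards [coeFn_lpClass (hmem a), coeFn_lpClass (hmem a₀),
      Lp.coeFn_sub (lpClass μ (K a)) (lpClass μ (K a₀))] with x h1 h2 h3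
    rw [h3, Pi.sub_apply, h1, h2, real_inner_self_eq_norm_sq]
  simp only [hsq]
  have hlim : Tendsto (fun a => ∫ x, ‖K a x - K a₀ x‖ ^ 2 ∂μ) (𝓝 a₀)
      (𝓝 (∫ x, ‖K a₀ x - K a₀ x‖ ^ 2 ∂μ)) := by
    -- Near `a₀` one has `b a < b a₀ + 1`, so this constant dominates the squared difference; it is
    -- integrable since μ is finite.
    refine tendsto_integral_filter_of_dominated_convergence
      (fun _ => (b a₀ + 1 + b a₀) ^ 2) ?_ ?_ (integrable_const _) ?_
    · exact Eventually.of_forall fun a =>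
        ((((hKa a).sub (hKa a₀)).norm).pow 2).aestronglyMeasurable
    · have : ∀ᶠ a in 𝓝 a₀, b a < b a₀ + 1 :=
        (hb.tendsto a₀).eventually (gt_mem_nhds (by linarith))
      filter_upwards [this] with a ha
      refine ae_of_all _ fun x => ?_
      rw [Real.norm_of_nonneg (by positivity)]
      refine pow_le_pow_left₀ (norm_nonneg _) ((norm_sub_le _ _).trans ?_) 2
      linarith [hKb a x, hKb a₀ x]
    · refine ae_of_all _ fun x => ?_
      have h1 : Continuous fun a => K a x := hK.comp (Continuous.prodMk_left x)
      exact (((h1.sub continuous_const).norm).pow 2).tendsto a₀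
  simpa [Function.comp_def] using (Real.continuous_sqrt.tendsto _).comp hlim

end LpClass

end AbrahamControl

namespace AbrahamControl

/-! ### Very weak solutions depend linearly and continuously on the boundary data -/

theorem continuous_gradient {ψ : E3 → ℝ} {n : WithTop ℕ∞} (h : ContDiff ℝ n ψ) (hn : n ≠ 0) :
    Continuous (gradient ψ) :=
  (InnerProductSpace.toDual ℝ E3).symm.continuous.comp (h.continuous_fderiv hn)

theorem hasCompactSupport_gradient {ψ : E3 → ℝ} (h : HasCompactSupport ψ) :
    HasCompactSupport (gradient ψ) :=
  (h.fderiv ℝ).comp_left (g := (InnerProductSpace.toDual ℝ E3).symm) (map_zero _)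

namespace IsTest

variable {U : Set E3} {ψ ψ' : E3 → ℝ}

theorem memLp (h : IsTest U ψ) (μ : Measure E3) [IsFiniteMeasure μ] : MemLp ψ 2 μ :=
  memLp_of_hasCompactSupport h.1.continuous h.2.1

theorem memLp_gradient (h : IsTest U ψ) (μ : Measure E3) [IsFiniteMeasure μ] :
    MemLp (gradient ψ) 2 μ :=
  memLp_of_hasCompactSupport (continuous_gradient h.1 (by simp)) (hasCompactSupport_gradient h.2.1)

theorem differentiableAt (h : IsTest U ψ) (x : E3) : DifferentiableAt ℝ ψ x :=
  (h.1.differentiable (by simp)).differentiableAt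

theorem add (h : IsTest U ψ) (h' : IsTest U ψ') : IsTest U (ψ + ψ') :=
  ⟨h.1.add h'.1, h.2.1.add h'.2.1, (tsupport_add ψ ψ').trans (union_subset h.2.2 h'.2.2)⟩

theorem smul (c : ℝ) (h : IsTest U ψ) : IsTest U (c • ψ) :=
  ⟨h.1.const_smul c, h.2.1.smul_left (f := fun _ => c),
    (closure_mono (Function.support_const_smul_subset c ψ)).trans h.2.2⟩

theorem gradient_add (h : IsTest U ψ) (h' : IsTest U ψ') :
    gradient (ψ + ψ') = gradient ψ + gradient ψ' := by
  funext x
  simp [gradient, fderiv_add (h.differentiableAt x) (h'.differentiableAt x)]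

theorem gradient_smul (c : ℝ) (h : IsTest U ψ) : gradient (c • ψ) = c • gradient ψ := by
  funext x
  simp [gradient, fderiv_const_smul (h.differentiableAt x)]

end IsTest

section Linear

variable {Ω : Set E3}

theorem MemH10.add {v v' : L2 Ω} {Dv Dv' : X Ω} (h : MemH10 Ω v Dv) (h' : MemH10 Ω v' Dv') :
    MemH10 Ω (v + v') (Dv + Dv') := by
  refine map_mem_closure₂ (f := fun a b : L2 Ω × X Ω => a + b) continuous_add h h' ?_
  rintro a ⟨ψ, hψ, h1, h2⟩ b ⟨ψ', hψ', h1', h2'⟩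
  refine ⟨ψ + ψ', hψ.add hψ', (Lp.coeFn_add _ _).trans (h1.add h1'), ?_⟩
  rw [hψ.gradient_add hψ']
  exact (Lp.coeFn_add _ _).trans (h2.add h2')

theorem MemH10.smul (c : ℝ) {v : L2 Ω} {Dv : X Ω} (h : MemH10 Ω v Dv) :
    MemH10 Ω (c • v) (c • Dv) := by
  refine map_mem_closure (f := fun a : L2 Ω × X Ω => c • a) (continuous_const_smul c) h ?_
  rintro a ⟨ψ, hψ, h1, h2⟩
  refine ⟨c • ψ, hψ.smul c, (Lp.coeFn_smul _ _).trans (h1.const_smul c), ?_⟩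
  rw [hψ.gradient_smul]
  exact (Lp.coeFn_smul _ _).trans (h2.const_smul c)

theorem integral_mul_eq_inner {μ : Measure E3} (f g : Lp ℝ 2 μ) :
    ∫ x, f x * g x ∂μ = inner ℝ f g := by
  rw [L2.inner_def]
  exact integral_congr_ae (ae_of_all _ fun x => by simp [mul_comm])

theorem integral_mul_eq_inner_lpClass {μ : Measure E3} (f : Lp ℝ 2 μ) {g : E3 → ℝ}
    (hg : MemLp g 2 μ) : ∫ x, f x * g x ∂μ = inner ℝ f (lpClass μ g) := by
  rw [inner_lpClass_right hg]
  exact integral_congr_ae (ae_of_all _ fun x => by simp [mul_comm])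

theorem solvesWeakPoisson_iff {g : L2 Ω} {Dw : X Ω} :
    SolvesWeakPoisson Ω g Dw ↔ ∀ v Dv, MemH10 Ω v Dv → inner ℝ Dw Dv = inner ℝ g v := by
  refine forall₃_congr fun v Dv h => ?_
  rw [integral_mul_eq_inner, L2.inner_def Dw]

theorem isVeryWeakSolution_iff {u : L2Bdry Ω} {η : L2 Ω} :
    IsVeryWeakSolution Ω u η ↔ ∀ v Dv Lv dn, MemH Ω v Dv Lv dn →
      inner ℝ η Lv = inner ℝ u dn := by
  refine forall₄_congr fun v Dv Lv dn => forall_congr' fun _ => ?_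
  rw [integral_mul_eq_inner, integral_mul_eq_inner, neg_add_eq_zero]

variable [IsFiniteMeasure (volume.restrict Ω)]

theorem memH10_of_isTest {ψ : E3 → ℝ} (h : IsTest Ω ψ) :
    MemH10 Ω (lpClass _ ψ) (lpClass _ (gradient ψ)) :=
  subset_closure ⟨ψ, h, coeFn_lpClass (h.memLp _), coeFn_lpClass (h.memLp_gradient _)⟩

theorem hasDiv_iff {f : X Ω} {d : L2 Ω} :
    HasDiv Ω f d ↔ ∀ ψ, IsTest Ω ψ →
      inner ℝ f (lpClass _ (gradient ψ)) = -inner ℝ d (lpClass _ ψ) := by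
  refine forall₂_congr fun ψ h => ?_
  rw [inner_lpClass_right (h.memLp_gradient _), integral_mul_eq_inner_lpClass _ (h.memLp _)]

theorem hasNormalTrace_iff [IsFiniteMeasure (surface Ω)] {f : X Ω} {d : L2 Ω} {b : L2Bdry Ω} :
    HasNormalTrace Ω f d b ↔ ∀ ψ, IsTest univ ψ →
      inner ℝ b (lpClass _ ψ) =
        inner ℝ f (lpClass _ (gradient ψ)) + inner ℝ d (lpClass _ ψ) := by
  refine forall₂_congr fun ψ h => ?_
  rw [inner_lpClass_right (h.memLp_gradient _), integral_mul_eq_inner_lpClass _ (h.memLp _),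
    integral_mul_eq_inner_lpClass _ (h.memLp _)]

/-- Green's formula extends from test functions to `H¹₀(Ω)`. -/
theorem HasDiv.solvesWeakPoisson {f : X Ω} {d : L2 Ω} (h : HasDiv Ω f d) :
    SolvesWeakPoisson Ω (-d) f := by
  rw [solvesWeakPoisson_iff]
  intro v Dv hv
  -- Both sides are continuous in the pair (function, gradient), so the identity passes from test
  -- functions to the closure defining H¹₀.
  have hcl : IsClosed {a : L2 Ω × X Ω | inner ℝ f a.2 = inner ℝ (-d) a.1} :=
    isClosed_eq (by fun_prop) (by fun_prop)
  refine (closure_minimal ?_ hcl) hv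
  rintro a ⟨ψ, hψ, h1, h2⟩
  rw [mem_ofPred_eq, ← lpClass_eq_of_ae h1, ← lpClass_eq_of_ae h2, hasDiv_iff.1 h ψ hψ,
    inner_neg_left]

/-- An element of `L²(Ω)` orthogonal to all test functions vanishes. -/
theorem eq_zero_of_inner_isTest (hΩ : IsOpen Ω) {f : L2 Ω}
    (h : ∀ ψ, IsTest Ω ψ → inner ℝ f (lpClass _ ψ) = 0) : f = 0 := by
  have hint : IntegrableOn f Ω volume := (Lp.memLp f).integrable (by norm_num)
  -- The fundamental lemma of the calculus of variations.
  have := hΩ.ae_eq_zero_of_integral_contDiff_smul_eq_zero hint.locallyIntegrableOn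
    (fun ψ h1 h2 h3 => by
      have hψ : IsTest Ω ψ := ⟨h1, h2, h3⟩
      have h0 := h ψ hψ
      rw [← integral_mul_eq_inner_lpClass _ (hψ.memLp _)] at h0
      rw [← h0, ← setIntegral_eq_integral_of_forall_compl_eq_zero]
      · exact integral_congr_ae (ae_of_all _ fun x => by simp [mul_comm])
      · intro x hx
        rw [image_eq_zero_of_notMem_tsupport (fun hx' => hx (h3 hx')), zero_smul])
  refine Lp.ext ?_
  rw [← ae_restrict_iff' hΩ.measurableSet] at this
  filter_upwards [this, Lp.coeFn_zero ℝ 2 (volume.restrict Ω)] with x h1 h2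
  rw [h1, h2, Pi.zero_apply]

variable [IsFiniteMeasure (surface Ω)]

theorem MemH.add {v v' : L2 Ω} {Dv Dv' : X Ω} {Lv Lv' : L2 Ω} {dn dn' : L2Bdry Ω}
    (h : MemH Ω v Dv Lv dn) (h' : MemH Ω v' Dv' Lv' dn') :
    MemH Ω (v + v') (Dv + Dv') (Lv + Lv') (dn + dn') := by
  refine ⟨h.1.add h'.1, hasDiv_iff.2 fun ψ hψ => ?_, hasNormalTrace_iff.2 fun ψ hψ => ?_⟩
  · simp only [inner_add_left, hasDiv_iff.1 h.2.1 ψ hψ, hasDiv_iff.1 h'.2.1 ψ hψ]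
    ring
  · simp only [inner_add_left, hasNormalTrace_iff.1 h.2.2 ψ hψ, hasNormalTrace_iff.1 h'.2.2 ψ hψ]
    ring

theorem MemH.smul (c : ℝ) {v : L2 Ω} {Dv : X Ω} {Lv : L2 Ω} {dn : L2Bdry Ω}
    (h : MemH Ω v Dv Lv dn) : MemH Ω (c • v) (c • Dv) (c • Lv) (c • dn) := by
  refine ⟨h.1.smul c, hasDiv_iff.2 fun ψ hψ => ?_, hasNormalTrace_iff.2 fun ψ hψ => ?_⟩
  · simp only [real_inner_smul_left, hasDiv_iff.1 h.2.1 ψ hψ]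
    ring
  · simp only [real_inner_smul_left, hasNormalTrace_iff.1 h.2.2 ψ hψ]
    ring

/-- `dn` is the normal derivative of the solution of the Poisson problem with right-hand side
`g`. -/
def IsPoissonFlux (Ω : Set E3) (g : L2 Ω) (dn : L2Bdry Ω) : Prop :=
  ∃ (w : L2 Ω) (Dw : X Ω) (Lw : L2 Ω), MemH Ω w Dw Lw dn ∧ SolvesWeakPoisson Ω g Dw

theorem IsPoissonFlux.add {g g' : L2 Ω} {dn dn' : L2Bdry Ω} (h : IsPoissonFlux Ω g dn)
    (h' : IsPoissonFlux Ω g' dn') : IsPoissonFlux Ω (g + g') (dn + dn') := by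
  obtain ⟨w, Dw, Lw, hw, hs⟩ := h
  obtain ⟨w', Dw', Lw', hw', hs'⟩ := h'
  refine ⟨_, _, _, hw.add hw', solvesWeakPoisson_iff.2 fun v Dv hv => ?_⟩
  rw [inner_add_left, inner_add_left, solvesWeakPoisson_iff.1 hs v Dv hv,
    solvesWeakPoisson_iff.1 hs' v Dv hv]

theorem IsPoissonFlux.smul (c : ℝ) {g : L2 Ω} {dn : L2Bdry Ω} (h : IsPoissonFlux Ω g dn) :
    IsPoissonFlux Ω (c • g) (c • dn) := by
  obtain ⟨w, Dw, Lw, hw, hs⟩ := h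
  refine ⟨_, _, _, hw.smul c, solvesWeakPoisson_iff.2 fun v Dv hv => ?_⟩
  rw [real_inner_smul_left, real_inner_smul_left, solvesWeakPoisson_iff.1 hs v Dv hv]

/-- The operator sending the right-hand side of the Poisson problem to the normal derivative of
the solution. -/
theorem exists_poissonFlux_operator (h : PoissonRegular Ω) :
    ∃ S : L2 Ω →L[ℝ] L2Bdry Ω, ∀ g dn, IsPoissonFlux Ω g dn ↔ S g = dn := by
  obtain ⟨hex, C, hC, hest⟩ := h
  have hbound : ∀ {g dn}, IsPoissonFlux Ω g dn → ‖dn‖ ≤ C * ‖g‖ := by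
    rintro g dn ⟨w, Dw, Lw, hw, hs⟩
    refine le_trans (Real.le_sqrt_of_sq_le ?_) (hest g w Dw Lw dn hw hs)
    nlinarith [sq_nonneg ‖w‖, sq_nonneg ‖Dw‖, sq_nonneg ‖Lw‖]
  -- The difference of two fluxes for `g` is a flux for `g - g = 0`, which the a priori estimate
  -- forces to vanish.
  have huniq : ∀ {g dn dn'}, IsPoissonFlux Ω g dn → IsPoissonFlux Ω g dn' → dn = dn' := by
    intro g dn dn' h h'
    have := hbound (h.add (h'.smul (-1)))
    rw [neg_one_smul, neg_one_smul, ← sub_eq_add_neg, ← sub_eq_add_neg, sub_self, norm_zero,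
      mul_zero, norm_le_zero_iff] at this
    exact sub_eq_zero.1 this
  have hflux : ∀ g, ∃ dn, IsPoissonFlux Ω g dn := by
    intro g
    obtain ⟨w, ⟨Dw, Lw, dn, hw⟩, -⟩ := hex g
    exact ⟨dn, w, Dw, Lw, hw⟩
  choose S hS using hflux
  let S' : L2 Ω →ₗ[ℝ] L2Bdry Ω :=
    { toFun := S
      map_add' := fun g g' => huniq (hS _) ((hS g).add (hS g'))
      map_smul' := fun c g => huniq (hS _) ((hS g).smul c) }
  refine ⟨S'.mkContinuous C fun g => hbound (hS g), fun g dn => ⟨fun h => huniq (hS g) h, ?_⟩⟩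
  rintro rfl
  exact hS g

/-- The very weak solution exists, is unique, and depends linearly and continuously on the
Dirichlet data. -/
theorem exists_potential_operator (hΩ : IsOpen Ω) (h : PoissonRegular Ω) :
    ∃ Λ : L2Bdry Ω →L[ℝ] L2 Ω, ∀ u η, IsVeryWeakSolution Ω u η ↔ η = Λ u := by
  obtain ⟨S, hS⟩ := exists_poissonFlux_operator h
  refine ⟨-ContinuousLinearMap.adjoint S, fun u η => ⟨fun hη => ?_, ?_⟩⟩
  · refine ext_inner_right ℝ fun g => ?_
    obtain ⟨w, Dw, Lw, hw, hs⟩ := (hS g _).2 rfl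
    -- The weak equation and Green's formula, both tested with C_c^∞ functions, identify the
    -- Laplacian. Every `g` thus arises as `-Lw`, so the very weak equation determines all inner
    -- products of `η`.
    have hL : Lw = -g := by
      rw [eq_neg_iff_add_eq_zero]
      refine eq_zero_of_inner_isTest hΩ fun ψ hψ => ?_
      have hmem := memH10_of_isTest hψ
      have h1 := solvesWeakPoisson_iff.1 hs _ _ hmem
      have h2 := solvesWeakPoisson_iff.1 hw.2.1.solvesWeakPoisson _ _ hmem
      rw [inner_neg_left] at h2
      rw [inner_add_left]
      linarith
    have := isVeryWeakSolution_iff.1 hη _ _ _ _ hw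
    rw [hL, inner_neg_right] at this
    rw [neg_apply, inner_neg_left, ContinuousLinearMap.adjoint_inner_left]
    linarith
  · rintro rfl
    rw [isVeryWeakSolution_iff]
    intro v Dv Lv dn hv
    -- Conversely, every `v` in 𝓗 is the Poisson solution for its own `-Lv`, so `dn = S (-Lv)`.
    have := (hS (-Lv) dn).1 ⟨v, Dv, Lv, hv, hv.2.1.solvesWeakPoisson⟩
    rw [neg_apply, inner_neg_left, ContinuousLinearMap.adjoint_inner_left,
      ← this, map_neg, inner_neg_right]

/-- Replaces the choice in `potential` by a bounded operator, whose norm bounds potentials and whose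
adjoint transfers weak convergence from controls to potentials. -/
theorem exists_potential_eq (hΩ : IsOpen Ω) (h : PoissonRegular Ω) :
    ∃ Λ : L2Bdry Ω →L[ℝ] L2 Ω, ∀ u, potential Ω u = Λ u := by
  obtain ⟨Λ, hΛ⟩ := exists_potential_operator hΩ h
  refine ⟨Λ, fun u => ?_⟩
  have hex : ∃ η, IsVeryWeakSolution Ω u η := ⟨Λ u, (hΛ u _).2 rfl⟩
  rw [potential, dif_pos hex]
  exact (hΛ u _).1 hex.choose_spec

end Linear

end AbrahamControl

namespace AbrahamControl

/-! ### Mild solutions -/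

section Mild

variable {H : Type*} [NormedAddCommGroup H] [NormedSpace ℝ H]

/-- The mild solution of `V' = A V + j`, `V(0) = V₀`, where `G` is the semigroup generated
by `A`. -/
noncomputable def mildSolution (G : ℝ → H →L[ℝ] H) (V₀ : H) (j : ℝ → H) (t : ℝ) : H :=
  G t V₀ + ∫ τ in (0 : ℝ)..t, G (t - τ) (j τ)

variable {G : ℝ → H →L[ℝ] H} {M T : ℝ}

/-- Clamping time to `[0, T]` makes the family bounded and strongly continuous on all of ℝ without
changing it on the interval of interest. -/
theorem continuous_apply_projIcc (hT : 0 ≤ T) (hG : ∀ V, ContinuousOn (fun t => G t V) (Ici 0))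
    (hM : ∀ t ∈ Icc 0 T, ‖G t‖ ≤ M) :
    Continuous fun p : ℝ × H => G (projIcc 0 T hT p.1) p.2 := by
  refine continuous_apply_of_strong (G := fun t => G (projIcc 0 T hT t))
    (fun s => hM _ (projIcc 0 T hT s).2) fun V => ?_
  exact (hG V).comp_continuous (continuous_subtype_val.comp continuous_projIcc)
    fun t => (projIcc 0 T hT t).2.1

theorem sub_mem_Icc_of_mem_uIoc {t τ : ℝ} (ht : t ∈ Icc 0 T) (hτ : τ ∈ uIoc 0 t) :
    τ ∈ Icc 0 T ∧ t - τ ∈ Icc 0 T := by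
  rw [uIoc_of_le ht.1] at hτ
  exact ⟨⟨hτ.1.le, hτ.2.trans ht.2⟩, ⟨by linarith [hτ.2], by linarith [hτ.1, ht.2]⟩⟩

theorem continuousOn_convolution (hG : ∀ V, ContinuousOn (fun t => G t V) (Ici 0))
    (hM : ∀ t ∈ Icc 0 T, ‖G t‖ ≤ M) {j : ℝ → H} (hj : ContinuousOn j (Icc 0 T)) {t : ℝ}
    (ht : t ∈ Icc 0 T) : ContinuousOn (fun τ => G (t - τ) (j τ)) (Icc 0 t) := by
  have hT : 0 ≤ T := ht.1.trans ht.2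
  have h := (continuous_apply_projIcc hT hG hM).comp_continuousOn
    ((continuousOn_const.sub continuousOn_id).prodMk (hj.mono (Icc_subset_Icc_right ht.2)) :
      ContinuousOn (fun τ => (t - τ, j τ)) (Icc 0 t))
  refine h.congr fun τ hτ => ?_
  have : t - τ ∈ Icc 0 T := ⟨by linarith [hτ.2], by linarith [hτ.1, ht.2]⟩
  simp [projIcc_of_mem hT this]

theorem norm_convolution_le (hM : ∀ t ∈ Icc 0 T, ‖G t‖ ≤ M) {j : ℝ → H} {C : ℝ}
    (hj : ∀ t ∈ Icc 0 T, ‖j t‖ ≤ C) {t τ : ℝ} (ht : t ∈ Icc 0 T) (hτ : τ ∈ uIoc 0 t) :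
    ‖G (t - τ) (j τ)‖ ≤ M * C := by
  obtain ⟨h1, h2⟩ := sub_mem_Icc_of_mem_uIoc ht hτ
  have hM0 : 0 ≤ M := (norm_nonneg _).trans (hM t ht)
  exact ((G (t - τ)).le_opNorm _).trans
    (mul_le_mul (hM _ h2) (hj _ h1) (norm_nonneg _) hM0)

theorem continuousOn_mildSolution (hG : ∀ V, ContinuousOn (fun t => G t V) (Ici 0))
    (hM : ∀ t ∈ Icc 0 T, ‖G t‖ ≤ M) (V₀ : H) {j : ℝ → H} (hj : ContinuousOn j (Icc 0 T)) :
    ContinuousOn (mildSolution G V₀ j) (Icc 0 T) := by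
  rcases lt_or_ge T 0 with hT | hT
  · simp [Icc_eq_empty_of_lt hT]
  have hc := continuous_apply_projIcc hT hG hM
  have hje : Continuous (IccExtend hT ((Icc 0 T).domRestrict j)) := hj.domRestrict.Icc_extend'
  -- With both the semigroup and the inhomogeneity extended to ℝ, the integrand is jointly
  -- continuous; for `t` in `[0, T]` only unextended values enter.
  have h : Continuous fun t => G (projIcc 0 T hT t) V₀ + ∫ τ in (0 : ℝ)..t,
      G (projIcc 0 T hT (t - τ)) (IccExtend hT ((Icc 0 T).domRestrict j) τ) := by
    refine (hc.comp (continuous_id.prodMk continuous_const)).add ?_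
    refine intervalIntegral.continuous_parametric_intervalIntegral_of_continuous ?_ continuous_id
    exact hc.comp ((continuous_fst.sub continuous_snd).prodMk (hje.comp continuous_snd))
  refine h.continuousOn.congr fun t ht => ?_
  simp only [mildSolution, projIcc_of_mem hT ht]
  congr 1
  refine intervalIntegral.integral_congr_ae (ae_of_all _ fun τ hτ => ?_)
  obtain ⟨h1, h2⟩ := sub_mem_Icc_of_mem_uIoc ht hτ
  rw [projIcc_of_mem hT h2, IccExtend_of_mem hT _ h1]
  rfl

theorem norm_mildSolution_le (hM : ∀ t ∈ Icc 0 T, ‖G t‖ ≤ M) (V₀ : H) {j : ℝ → H} {C : ℝ}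
    (hC : 0 ≤ C) (hj : ∀ t ∈ Icc 0 T, ‖j t‖ ≤ C) {t : ℝ} (ht : t ∈ Icc 0 T) :
    ‖mildSolution G V₀ j t‖ ≤ M * ‖V₀‖ + M * C * T := by
  have hM0 : 0 ≤ M := (norm_nonneg _).trans (hM t ht)
  refine (norm_add_le _ _).trans (add_le_add (((G t).le_opNorm _).trans
    (mul_le_mul_of_nonneg_right (hM t ht) (norm_nonneg _))) ?_)
  refine (intervalIntegral.norm_integral_le_of_norm_le_const
    fun τ hτ => norm_convolution_le hM hj ht hτ).trans ?_
  rw [sub_zero, abs_of_nonneg ht.1]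
  exact mul_le_mul_of_nonneg_left ht.2 (mul_nonneg hM0 hC)

/-- Mild solutions converge when the inhomogeneities converge pointwise and boundedly. -/
theorem tendsto_mildSolution (hG : ∀ V, ContinuousOn (fun t => G t V) (Ici 0))
    (hM : ∀ t ∈ Icc 0 T, ‖G t‖ ≤ M) (V₀ : H) {j : ℕ → ℝ → H} {j' : ℝ → H} {C : ℝ}
    (hj : ∀ n, ContinuousOn (j n) (Icc 0 T)) (hC : ∀ n, ∀ t ∈ Icc 0 T, ‖j n t‖ ≤ C)
    (hlim : ∀ t ∈ Icc 0 T, Tendsto (fun n => j n t) atTop (𝓝 (j' t))) {t : ℝ}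
    (ht : t ∈ Icc 0 T) :
    Tendsto (fun n => mildSolution G V₀ (j n) t) atTop (𝓝 (mildSolution G V₀ j' t)) := by
  refine tendsto_const_nhds.add ?_
  refine intervalIntegral.tendsto_integral_filter_of_dominated_convergence (fun _ => M * C)
    (Eventually.of_forall fun n => ?_) (Eventually.of_forall fun n => ae_of_all _ fun τ hτ =>
      norm_convolution_le hM (hC n) ht hτ) intervalIntegrable_const
    (ae_of_all _ fun τ hτ => ?_)
  · rw [uIoc_of_le ht.1]
    exact ((continuousOn_convolution hG hM (hj n) ht).mono
      Ioc_subset_Icc_self).aestronglyMeasurable measurableSet_Ioc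
  · exact ((G (t - τ)).continuous.tendsto _).comp (hlim τ (sub_mem_Icc_of_mem_uIoc ht hτ).1)

end Mild

/-- Strong continuity, the only property of the Maxwell semigroup needed for the existence of an
optimal control. -/
theorem continuousOn_maxwellSemigroup (Ω : Set E3) (V : X Ω × X Ω) :
    ContinuousOn (fun t => maxwellSemigroup Ω t V) (Ici 0) := by
  by_cases h : ∃ G, IsMaxwellSemigroup Ω G
  · rw [maxwellSemigroup, dif_pos h]
    exact h.choose_spec.1.cont V
  -- The default value is the zero family, which is strongly continuous too.
  · rw [maxwellSemigroup, dif_neg h]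
    exact continuousOn_const

/-! ### The vector product -/

theorem inner_eq_sum (a b : E3) : inner ℝ a b = a 0 * b 0 + a 1 * b 1 + a 2 * b 2 := by
  simp [PiLp.inner_apply, Fin.sum_univ_three, mul_comm]

theorem cross_apply_zero (a b : E3) : cross a b 0 = a 1 * b 2 - a 2 * b 1 := by
  simp [cross, cross_apply]

theorem cross_apply_one (a b : E3) : cross a b 1 = a 2 * b 0 - a 0 * b 2 := by
  simp [cross, cross_apply]

theorem cross_apply_two (a b : E3) : cross a b 2 = a 0 * b 1 - a 1 * b 0 := by
  simp [cross, cross_apply]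

/-- This identity and the next one free the field, respectively ∇φ, from the vector product, so that
the rest can be absorbed into an L² kernel. -/
theorem inner_cross_eq_cross_inner (a b d : E3) :
    inner ℝ a (cross b d) = inner ℝ (cross a b) d := by
  simp only [inner_eq_sum, cross_apply_zero, cross_apply_one, cross_apply_two]
  ring

theorem inner_cross_rotate (a b d : E3) : inner ℝ a (cross b d) = inner ℝ b (cross d a) := by
  simp only [inner_eq_sum, cross_apply_zero, cross_apply_one, cross_apply_two]
  ring

theorem norm_cross_le (a b : E3) : ‖cross a b‖ ≤ ‖a‖ * ‖b‖ := by
  refine abs_le_of_sq_le_sq' ?_ (by positivity) |>.2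
  rw [mul_pow]
  simp only [← real_inner_self_eq_norm_sq]
  -- Lagrange's identity.
  have : inner ℝ a a * inner ℝ b b - inner ℝ (cross a b) (cross a b) = (inner ℝ a b) ^ 2 := by
    simp only [inner_eq_sum, cross_apply_zero, cross_apply_one, cross_apply_two]
    ring
  nlinarith [sq_nonneg (inner ℝ a b)]

theorem continuous_cross : Continuous fun p : E3 × E3 => cross p.1 p.2 := by
  refine (PiLp.continuous_toLp 2 _).comp (continuous_pi fun i => ?_)
  fin_cases i <;> simp [cross_apply] <;> fun_prop

/-- The vector product with a fixed left factor as a continuous linear map. -/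
noncomputable def crossCLM (a : E3) : E3 →L[ℝ] E3 :=
  LinearMap.mkContinuous
    { toFun := cross a
      map_add' := fun b d => by simp [cross]
      map_smul' := fun r b => by simp [cross] } ‖a‖ fun b => norm_cross_le a b

end AbrahamControl

/-! ### Charge density, fields and forces under the standing assumptions -/

namespace AbrahamControl

namespace ProblemData

variable {P : ProblemData}

namespace StandingAssumptions

theorem isFiniteMeasure_volume (hP : P.StandingAssumptions) :
    IsFiniteMeasure (volume.restrict P.Ω) :=
  ⟨by rw [Measure.restrict_apply_univ]; exact hP.isBounded.measure_lt_top⟩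

theorem isFiniteMeasure_surface (hP : P.StandingAssumptions) : IsFiniteMeasure (surface P.Ω) :=
  ⟨hP.surface_finite⟩

theorem hasCompactSupport_φ (hP : P.StandingAssumptions) : HasCompactSupport P.φ :=
  (isCompact_closedBall 0 P.R).of_isClosed_subset (isClosed_tsupport _) hP.φ_support

theorem continuous_φ (hP : P.StandingAssumptions) : Continuous P.φ := hP.φ_contDiff.continuous

theorem continuous_gradient_φ (hP : P.StandingAssumptions) : Continuous (gradient P.φ) :=
  continuous_gradient hP.φ_contDiff two_ne_zero

theorem exists_bound_φ (hP : P.StandingAssumptions) : ∃ C, 0 ≤ C ∧ ∀ x, ‖P.φ x‖ ≤ C :=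
  let ⟨C, hC⟩ := hP.hasCompactSupport_φ.exists_bound_of_continuous hP.continuous_φ
  ⟨C, (norm_nonneg _).trans (hC 0), hC⟩

theorem exists_bound_gradient_φ (hP : P.StandingAssumptions) :
    ∃ C, 0 ≤ C ∧ ∀ x, ‖gradient P.φ x‖ ≤ C :=
  let ⟨C, hC⟩ := (hasCompactSupport_gradient hP.hasCompactSupport_φ).exists_bound_of_continuous
    hP.continuous_gradient_φ
  ⟨C, (norm_nonneg _).trans (hC 0), hC⟩

/-- A boundary point is farther than `R` from `a`, while φ is supported in the ball of radius `R`.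
This removes the boundary integral from the momentum equation. -/
theorem φ_sub_eq_zero (hP : P.StandingAssumptions) {a x : E3} (ha : a ∈ P.admissible)
    (hx : x ∈ frontier P.Ω) : P.φ (x - a) = 0 := by
  refine image_eq_zero_of_notMem_tsupport fun h => ?_
  have h1 := hP.φ_support h
  rw [mem_closedBall_zero_iff, ← dist_eq_norm, dist_comm] at h1
  exact absurd (hP.admissible_dist a ha x hx) (not_lt.2 h1)

end StandingAssumptions

/-! ### Velocity -/

theorem one_le_γ (p : E3) : 1 ≤ P.γ p :=
  Real.one_le_sqrt.2 (le_add_of_nonneg_right (by positivity))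

theorem continuous_γ : Continuous P.γ := by
  unfold γ
  fun_prop

theorem continuous_v (hP : P.StandingAssumptions) : Continuous P.v := by
  refine ((continuous_const.mul continuous_γ).inv₀ fun p => ?_).smul continuous_id
  exact mul_ne_zero hP.m₀_pos.ne' (zero_lt_one.trans_le (one_le_γ p)).ne'

/-- The Lorentz factor is at least `‖p‖ / (m₀ c)`. -/
theorem norm_v_le (hP : P.StandingAssumptions) (p : E3) : ‖P.v p‖ ≤ P.c := by
  have hm := hP.m₀_pos
  have hc := hP.c_pos
  have hγ : 0 < P.γ p := zero_lt_one.trans_le (one_le_γ p)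
  have h1 : ‖p‖ / (P.m₀ * P.c) ≤ P.γ p := by
    refine Real.le_sqrt_of_sq_le ?_
    rw [div_pow]
    linarith
  rw [v, norm_smul, norm_inv, Real.norm_of_nonneg (by positivity), inv_mul_le_iff₀ (by positivity)]
  rw [div_le_iff₀ (by positivity)] at h1
  linarith

theorem continuous_β (hP : P.StandingAssumptions) : Continuous P.β := by
  have hv := continuous_v hP
  unfold β
  fun_prop

theorem norm_β_le (hP : P.StandingAssumptions) (p : E3) : ‖P.β p‖ ≤ 1 := by
  have hc := hP.c_pos
  rw [β, norm_smul, norm_inv, Real.norm_of_nonneg hc.le, inv_mul_le_iff₀ hc, mul_one]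
  exact norm_v_le hP p

/-! ### The electromagnetic field -/

/-- The current density of a particle with position `a` and momentum `b`. -/
noncomputable def currentAt (P : ProblemData) (a b : E3) : X P.Ω × X P.Ω :=
  (lpClass _ (fun x => -(P.q * P.φ (x - a)) • P.v b), 0)

theorem continuous_currentAt (hP : P.StandingAssumptions) :
    Continuous fun y : E3 × E3 => P.currentAt y.1 y.2 := by
  have := hP.isFiniteMeasure_volume
  obtain ⟨C, hC0, hC⟩ := hP.exists_bound_φ
  have hφ := hP.continuous_φ
  have hv := continuous_v hP
  refine Continuous.prodMk (continuous_lpClass (b := fun _ => P.q * C * P.c) ?_ continuous_const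
    fun y x => ?_) continuous_const
  · simp only [Function.uncurry_def]
    fun_prop
  · rw [norm_smul, norm_neg, norm_mul, Real.norm_of_nonneg hP.q_pos.le]
    exact mul_le_mul (mul_le_mul_of_nonneg_left (hC _) hP.q_pos.le) (norm_v_le hP _)
      (norm_nonneg _) (mul_nonneg hP.q_pos.le hC0)

theorem exists_bound_currentAt (hP : P.StandingAssumptions) :
    ∃ C, 0 ≤ C ∧ ∀ a b, ‖P.currentAt a b‖ ≤ C := by
  have := hP.isFiniteMeasure_volume
  obtain ⟨C, hC0, hC⟩ := hP.exists_bound_φ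
  have hφ := hP.continuous_φ
  have h0 : 0 ≤ P.q * C * P.c := mul_nonneg (mul_nonneg hP.q_pos.le hC0) hP.c_pos.le
  obtain ⟨m, hm0, hm⟩ := exists_norm_lpClass_le (F := E3) (volume.restrict P.Ω)
  refine ⟨m * (P.q * C * P.c), mul_nonneg hm0 h0, fun a b => ?_⟩
  rw [currentAt, Prod.norm_mk, norm_zero, max_eq_left (norm_nonneg _)]
  refine hm _ _ (by fun_prop) h0 fun x => ?_
  rw [norm_smul, norm_neg, norm_mul, Real.norm_of_nonneg hP.q_pos.le]
  exact mul_le_mul (mul_le_mul_of_nonneg_left (hC _) hP.q_pos.le) (norm_v_le hP _)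
    (norm_nonneg _) (mul_nonneg hP.q_pos.le hC0)

theorem continuousOn_current (hP : P.StandingAssumptions) {r p : ℝ → E3} {s : Set ℝ}
    (hr : ContinuousOn r s) (hp : ContinuousOn p s) : ContinuousOn (P.current r p) s := by
  have h : ContinuousOn (fun t => (r t, p t)) s := hr.prodMk hp
  have hcomp := (continuous_currentAt hP).comp_continuousOn h
  -- `toX` and `lpClass` have the same body, so `current r p t` is definitionally `currentAt (r t)
  -- (p t)`.
  exact hcomp

theorem continuousOn_field (hP : P.StandingAssumptions) {r p : ℝ → E3}
    (hr : ContinuousOn r (Icc 0 P.T)) (hp : ContinuousOn p (Icc 0 P.T)) :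
    ContinuousOn (P.field r p) (Icc 0 P.T) :=
  let ⟨_, _, hM⟩ := exists_norm_le_of_strong (continuousOn_maxwellSemigroup P.Ω) P.T
  continuousOn_mildSolution (continuousOn_maxwellSemigroup P.Ω) hM _
    (continuousOn_current hP hr hp)

/-- The fields generated by all possible trajectories are uniformly bounded. -/
theorem exists_bound_field (hP : P.StandingAssumptions) :
    ∃ C, 0 ≤ C ∧ ∀ r p, ∀ t ∈ Icc 0 P.T, ‖P.field r p t‖ ≤ C := by
  obtain ⟨M, hM0, hM⟩ := exists_norm_le_of_strong (continuousOn_maxwellSemigroup P.Ω) P.T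
  obtain ⟨C, hC0, hC⟩ := exists_bound_currentAt hP
  have hT := hP.T_pos
  exact ⟨M * ‖(P.E₀, P.B₀)‖ + M * C * P.T, by positivity, fun r p t ht =>
    norm_mildSolution_le hM _ hC0 (fun τ _ => hC _ _) ht⟩

/-- The field depends continuously on the trajectory. -/
theorem tendsto_field (hP : P.StandingAssumptions) {r p : ℕ → ℝ → E3} {r' p' : ℝ → E3}
    (hr : ∀ n, ContinuousOn (r n) (Icc 0 P.T)) (hp : ∀ n, ContinuousOn (p n) (Icc 0 P.T))
    (hr' : ∀ t ∈ Icc 0 P.T, Tendsto (fun n => r n t) atTop (𝓝 (r' t)))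
    (hp' : ∀ t ∈ Icc 0 P.T, Tendsto (fun n => p n t) atTop (𝓝 (p' t))) {t : ℝ}
    (ht : t ∈ Icc 0 P.T) :
    Tendsto (fun n => P.field (r n) (p n) t) atTop (𝓝 (P.field r' p' t)) := by
  obtain ⟨M, -, hM⟩ := exists_norm_le_of_strong (continuousOn_maxwellSemigroup P.Ω) P.T
  obtain ⟨C, -, hC⟩ := exists_bound_currentAt hP
  refine tendsto_mildSolution (continuousOn_maxwellSemigroup P.Ω) hM _
    (fun n => continuousOn_current hP (hr n) (hp n)) (fun n τ _ => hC _ _) (fun τ hτ => ?_) ht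
  have h : Tendsto (fun n => (r n τ, p n τ)) atTop (𝓝 (r' τ, p' τ)) :=
    (hr' τ hτ).prodMk_nhds (hp' τ hτ)
  have hcomp := ((continuous_currentAt hP).tendsto (r' τ, p' τ)).comp h
  exact hcomp

/-! ### The force acting on the particle -/

/-- The force on a particle with position `a` and momentum `b` in the field `V` and the external
field with potential `η`, when the support of the charge does not meet the boundary. -/
noncomputable def force (P : ProblemData) (a b : E3) (V : X P.Ω × X P.Ω) (η : L2 P.Ω) : E3 :=
  P.q • (∫ x in P.Ω, P.φ (x - a) • (V.1 x + cross (P.β b) (V.2 x)))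
    - P.q • (∫ x in P.Ω, η x • cross (gradient P.φ (x - a)) (P.β b))

/-- The class of `φ(· - a) d` in `X`. -/
noncomputable def chargeClass (P : ProblemData) (a d : E3) : X P.Ω :=
  lpClass _ fun x => P.φ (x - a) • d

/-- The class of the directional derivative of `φ(· - a)` along `d` in `L²(Ω)`. -/
noncomputable def slopeClass (P : ProblemData) (a d : E3) : L2 P.Ω :=
  lpClass _ fun x => inner ℝ (gradient P.φ (x - a)) d

theorem continuous_chargeClass (hP : P.StandingAssumptions) :
    Continuous fun y : E3 × E3 => P.chargeClass y.1 y.2 := by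
  have := hP.isFiniteMeasure_volume
  obtain ⟨C, hC0, hC⟩ := hP.exists_bound_φ
  have hφ := hP.continuous_φ
  refine continuous_lpClass (b := fun y : E3 × E3 => C * ‖y.2‖) ?_ (by fun_prop) fun y x => ?_
  · simp only [Function.uncurry_def]
    fun_prop
  · rw [norm_smul]
    exact mul_le_mul_of_nonneg_right (hC _) (norm_nonneg _)

theorem continuous_slopeClass (hP : P.StandingAssumptions) :
    Continuous fun y : E3 × E3 => P.slopeClass y.1 y.2 := by
  have := hP.isFiniteMeasure_volume
  obtain ⟨C, hC0, hC⟩ := hP.exists_bound_gradient_φ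
  have hφ := hP.continuous_gradient_φ
  refine continuous_lpClass (b := fun y : E3 × E3 => C * ‖y.2‖) ?_ (by fun_prop) fun y x => ?_
  · simp only [Function.uncurry_def]
    fun_prop
  · exact (norm_inner_le_norm _ _).trans (mul_le_mul_of_nonneg_right (hC _) (norm_nonneg _))

theorem exists_bound_chargeClass (hP : P.StandingAssumptions) :
    ∃ C, 0 ≤ C ∧ ∀ a d, ‖P.chargeClass a d‖ ≤ C * ‖d‖ := by
  have := hP.isFiniteMeasure_volume
  obtain ⟨C, hC0, hC⟩ := hP.exists_bound_φ
  have hφ := hP.continuous_φ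
  obtain ⟨m, hm0, hm⟩ := exists_norm_lpClass_le (F := E3) (volume.restrict P.Ω)
  refine ⟨m * C, mul_nonneg hm0 hC0, fun a d => ?_⟩
  rw [mul_assoc]
  refine hm _ _ (by fun_prop) (by positivity) fun x => ?_
  rw [norm_smul]
  exact mul_le_mul_of_nonneg_right (hC _) (norm_nonneg _)

theorem exists_bound_slopeClass (hP : P.StandingAssumptions) :
    ∃ C, 0 ≤ C ∧ ∀ a d, ‖P.slopeClass a d‖ ≤ C * ‖d‖ := by
  have := hP.isFiniteMeasure_volume
  obtain ⟨C, hC0, hC⟩ := hP.exists_bound_gradient_φ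
  have hφ := hP.continuous_gradient_φ
  obtain ⟨m, hm0, hm⟩ := exists_norm_lpClass_le (F := ℝ) (volume.restrict P.Ω)
  refine ⟨m * C, mul_nonneg hm0 hC0, fun a d => ?_⟩
  rw [mul_assoc]
  refine hm _ _ (by fun_prop) (by positivity) fun x => ?_
  exact (norm_inner_le_norm _ _).trans (mul_le_mul_of_nonneg_right (hC _) (norm_nonneg _))

/-- The components of the force are inner products of the fields with smooth kernels. -/
theorem inner_force (hP : P.StandingAssumptions) (a b : E3) (V : X P.Ω × X P.Ω) (η : L2 P.Ω)
    (e : E3) :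
    inner ℝ e (P.force a b V η) =
      P.q * (inner ℝ V.1 (P.chargeClass a e) + inner ℝ V.2 (P.chargeClass a (cross e (P.β b))))
        - P.q * inner ℝ η (P.slopeClass a (cross (P.β b) e)) := by
  have := hP.isFiniteMeasure_volume
  obtain ⟨C, hC0, hC⟩ := hP.exists_bound_φ
  obtain ⟨C', hC0', hC'⟩ := hP.exists_bound_gradient_φ
  have hφ := hP.continuous_φ
  have hφ' := hP.continuous_gradient_φ
  have hkc : ∀ d : E3, MemLp (fun x => P.φ (x - a) • d) 2 (volume.restrict P.Ω) := fun d =>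
    memLp_of_continuous_of_bound (C := C * ‖d‖) (by fun_prop) fun x => by
      rw [norm_smul]
      exact mul_le_mul_of_nonneg_right (hC _) (norm_nonneg _)
  have hks : ∀ d, MemLp (fun x => inner ℝ (gradient P.φ (x - a)) d) 2 (volume.restrict P.Ω) :=
    fun d => memLp_of_continuous_of_bound (C := C' * ‖d‖) (by fun_prop) fun x =>
      (norm_inner_le_norm _ _).trans (mul_le_mul_of_nonneg_right (hC' _) (norm_nonneg _))
  have hV : ∀ W : X P.Ω, Integrable W (volume.restrict P.Ω) := fun W =>
    (Lp.memLp W).integrable (by norm_num)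
  have hη : Integrable η (volume.restrict P.Ω) := (Lp.memLp η).integrable (by norm_num)
  -- Integrability of the vector-valued integrands allows the inner product with `e` to be moved
  -- under the integrals.
  have hL : Integrable (fun x => V.1 x + cross (P.β b) (V.2 x)) (volume.restrict P.Ω) :=
    (hV V.1).add ((crossCLM (P.β b)).integrable_comp (hV V.2))
  have hφL : Integrable (fun x => P.φ (x - a) • (V.1 x + cross (P.β b) (V.2 x)))
      (volume.restrict P.Ω) :=
    hL.bdd_smul C (by fun_prop) (ae_of_all _ fun x => hC _)
  have hηs : Integrable (fun x => η x • cross (gradient P.φ (x - a)) (P.β b))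
      (volume.restrict P.Ω) := by
    refine hη.smul_bdd (C' * ‖P.β b‖) ?_ (ae_of_all _ fun x => ?_)
    · exact (continuous_cross.comp ((hφ'.comp (continuous_id.sub continuous_const)).prodMk
        continuous_const)).aestronglyMeasurable
    · exact (norm_cross_le _ _).trans (mul_le_mul_of_nonneg_right (hC' _) (norm_nonneg _))
  have hi : ∀ (W : X P.Ω) (d : E3), Integrable
      (fun x => inner ℝ (W x) (P.φ (x - a) • d)) (volume.restrict P.Ω) := fun W d => by
    refine (L2.integrable_inner (𝕜 := ℝ) W ((hkc d).toLp _)).congr ?_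
    filter_upwards [(hkc d).coeFn_toLp] with x hx
    rw [hx]
  rw [force, inner_sub_right, real_inner_smul_right, real_inner_smul_right,
    ← integral_inner hφL, ← integral_inner hηs, chargeClass, chargeClass, slopeClass,
    inner_lpClass_right (hkc _), inner_lpClass_right (hkc _), inner_lpClass_right (hks _),
    ← integral_add (hi _ _) (hi _ _)]
  congr 2
  · refine integral_congr_ae (ae_of_all _ fun x => ?_)
    simp only [real_inner_smul_right, inner_add_right, inner_cross_eq_cross_inner e]
    rw [real_inner_comm e, real_inner_comm (cross e (P.β b))]
    ring
  · refine integral_congr_ae (ae_of_all _ fun x => ?_)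
    simp only [real_inner_smul_right, inner_cross_rotate e]
    simp [mul_comm]

/-- In finite dimensions weak convergence is convergence, so the force can be treated one component
at a time. -/
theorem tendsto_of_forall_inner {ι : Type*} {l : Filter ι} {f : ι → E3} {a : E3}
    (h : ∀ e, Tendsto (fun n => inner ℝ e (f n)) l (𝓝 (inner ℝ e a))) : Tendsto f l (𝓝 a) := by
  have h1 : Tendsto (fun n => (f n).ofLp) l (𝓝 a.ofLp) := by
    refine tendsto_pi_nhds.2 fun i => ?_
    simpa [EuclideanSpace.inner_single_left] using h (EuclideanSpace.single i 1)
  exact ((PiLp.continuous_toLp 2 _).tendsto a.ofLp).comp h1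

/-- The force is continuous with respect to strong convergence of the trajectory and the field and
weak convergence of the potential. -/
theorem tendsto_force (hP : P.StandingAssumptions) {a b : ℕ → E3} {a' b' : E3}
    {V : ℕ → X P.Ω × X P.Ω} {V' : X P.Ω × X P.Ω} {η : ℕ → L2 P.Ω} {η' : L2 P.Ω} {C : ℝ}
    (ha : Tendsto a atTop (𝓝 a')) (hb : Tendsto b atTop (𝓝 b')) (hV : Tendsto V atTop (𝓝 V'))
    (hη : ∀ n, ‖η n‖ ≤ C)
    (hη' : ∀ y, Tendsto (fun n => inner ℝ (η n) y) atTop (𝓝 (inner ℝ η' y))) :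
    Tendsto (fun n => P.force (a n) (b n) (V n) (η n)) atTop (𝓝 (P.force a' b' V' η')) := by
  refine tendsto_of_forall_inner fun e => ?_
  simp only [inner_force hP]
  have hβ : Tendsto (fun n => P.β (b n)) atTop (𝓝 (P.β b')) :=
    ((continuous_β hP).tendsto b').comp hb
  have hcr : ∀ {f g : ℕ → E3} {f' g' : E3}, Tendsto f atTop (𝓝 f') → Tendsto g atTop (𝓝 g') →
      Tendsto (fun n => cross (f n) (g n)) atTop (𝓝 (cross f' g')) := fun {f g f' g'} hf hg => by
    have h : Tendsto (fun n => (f n, g n)) atTop (𝓝 (f', g')) := hf.prodMk_nhds hg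
    have hcomp := (continuous_cross.tendsto (f', g')).comp h
    exact hcomp
  have hch : ∀ {g : ℕ → E3} {g' : E3}, Tendsto g atTop (𝓝 g') →
      Tendsto (fun n => P.chargeClass (a n) (g n)) atTop (𝓝 (P.chargeClass a' g')) :=
    fun {g g'} hg => by
      have h : Tendsto (fun n => (a n, g n)) atTop (𝓝 (a', g')) := ha.prodMk_nhds hg
      have hcomp := ((continuous_chargeClass hP).tendsto (a', g')).comp h
      exact hcomp
  have hsl : ∀ {g : ℕ → E3} {g' : E3}, Tendsto g atTop (𝓝 g') →
      Tendsto (fun n => P.slopeClass (a n) (g n)) atTop (𝓝 (P.slopeClass a' g')) :=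
    fun {g g'} hg => by
      have h : Tendsto (fun n => (a n, g n)) atTop (𝓝 (a', g')) := ha.prodMk_nhds hg
      have hcomp := ((continuous_slopeClass hP).tendsto (a', g')).comp h
      exact hcomp
  have hV1 : Tendsto (fun n => (V n).1) atTop (𝓝 V'.1) := hV.fst_nhds
  have hV2 : Tendsto (fun n => (V n).2) atTop (𝓝 V'.2) := hV.snd_nhds
  have he : Tendsto (fun _ : ℕ => e) atTop (𝓝 e) := tendsto_const_nhds
  have h1 := hV1.inner (𝕜 := ℝ) (hch he)
  have h2 := hV2.inner (𝕜 := ℝ) (hch (hcr he hβ))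
  have h3 := tendsto_inner_of_weak_of_strong hη hη' (hsl (hcr hβ he))
  exact ((h1.add h2).const_mul _).sub (h3.const_mul _)

theorem continuous_force (hP : P.StandingAssumptions) (η : L2 P.Ω) :
    Continuous fun y : E3 × E3 × (X P.Ω × X P.Ω) => P.force y.1 y.2.1 y.2.2 η := by
  -- A constant sequence of potentials is bounded and weakly convergent, so `tendsto_force` applies.
  refine continuous_iff_seqContinuous.2 fun y y' hy => ?_
  exact tendsto_force hP ((continuous_fst.tendsto y').comp hy)
    (((continuous_fst.comp continuous_snd).tendsto y').comp hy)
    (((continuous_snd.comp continuous_snd).tendsto y').comp hy) (fun _ => le_rfl)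
    fun _ => tendsto_const_nhds

theorem exists_bound_force (hP : P.StandingAssumptions) (CV Cη : ℝ) :
    ∃ K, 0 ≤ K ∧ ∀ a b V η, ‖V‖ ≤ CV → ‖η‖ ≤ Cη → ‖P.force a b V η‖ ≤ K := by
  obtain ⟨C, hC0, hC⟩ := exists_bound_chargeClass hP
  obtain ⟨C', hC0', hC'⟩ := exists_bound_slopeClass hP
  refine ⟨P.q * (|CV| * C + |CV| * C + |Cη| * C'), mul_nonneg hP.q_pos.le (by positivity), ?_⟩
  intro a b V η hV hη
  have hV1 : ‖V.1‖ ≤ |CV| := ((norm_fst_le V).trans hV).trans (le_abs_self _)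
  have hV2 : ‖V.2‖ ≤ |CV| := ((norm_snd_le V).trans hV).trans (le_abs_self _)
  have hη1 : ‖η‖ ≤ |Cη| := hη.trans (le_abs_self _)
  -- The force is tested with itself, which gives `‖e‖ ^ 2 ≤ K * ‖e‖`; division by `‖e‖` is possible
  -- unless it is zero.
  set e := P.force a b V η with he
  have hcr : ‖cross e (P.β b)‖ ≤ ‖e‖ := (norm_cross_le _ _).trans
    (mul_le_of_le_one_right (norm_nonneg _) (norm_β_le hP b))
  have hcr' : ‖cross (P.β b) e‖ ≤ ‖e‖ := (norm_cross_le _ _).trans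
    (mul_le_of_le_one_left (norm_nonneg _) (norm_β_le hP b))
  have h1 : inner ℝ V.1 (P.chargeClass a e) ≤ |CV| * (C * ‖e‖) :=
    (real_inner_le_norm _ _).trans (mul_le_mul hV1 (hC _ _) (norm_nonneg _) (abs_nonneg _))
  have h2 : inner ℝ V.2 (P.chargeClass a (cross e (P.β b))) ≤ |CV| * (C * ‖e‖) :=
    (real_inner_le_norm _ _).trans (mul_le_mul hV2 ((hC _ _).trans
      (mul_le_mul_of_nonneg_left hcr hC0)) (norm_nonneg _) (abs_nonneg _))
  have h3 : -inner ℝ η (P.slopeClass a (cross (P.β b) e)) ≤ |Cη| * (C' * ‖e‖) :=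
    (neg_le_abs _).trans ((abs_real_inner_le_norm _ _).trans (mul_le_mul hη1 ((hC' _ _).trans
      (mul_le_mul_of_nonneg_left hcr' hC0')) (norm_nonneg _) (abs_nonneg _)))
  have h4 : ‖e‖ * ‖e‖ ≤ P.q * (|CV| * C + |CV| * C + |Cη| * C') * ‖e‖ := by
    rw [← real_inner_self_eq_norm_mul_norm]
    conv_lhs => rw [he, inner_force hP, ← he]
    nlinarith [hP.q_pos]
  rcases (norm_nonneg e).eq_or_lt with h0 | h0
  · rw [← h0]
    exact mul_nonneg hP.q_pos.le (by positivity)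
  · exact le_of_mul_le_mul_right h4 h0

/-- Under the state constraint the boundary term vanishes, and the momentum equation reduces to
Newton's law with force `force`. -/
theorem e₁_eq (hP : P.StandingAssumptions) {w : ℝ → E3} (z : ℝ → E3) (u : L2Bdry P.Ω) {t : ℝ}
    (hw : w t + P.r₀ ∈ P.admissible) :
    P.e₁ w z u t = derivWithin z (Icc 0 P.T) t - P.force (w t + P.r₀) (z t + P.p₀)
      (P.field (fun s => w s + P.r₀) (fun s => z s + P.p₀) t) (potential P.Ω u) := by
  have hbd : ∫ x, (u x * P.φ (x - w t - P.r₀)) •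
      cross (P.β (z t + P.p₀)) (normal P.Ω x) ∂(surface P.Ω) = 0 := by
    refine setIntegral_eq_zero_of_forall_eq_zero fun x hx => ?_
    rw [sub_sub, hP.φ_sub_eq_zero hw hx, mul_zero, zero_smul]
  rw [e₁, hbd, smul_zero, sub_zero, force]
  simp only [sub_sub, lorentz]
  abel

end ProblemData

end AbrahamControl

namespace AbrahamControl

/-! ### Limits of continuously differentiable curves -/

theorem eq_integral_derivWithin {E : Type*} [NormedAddCommGroup E] [NormedSpace ℝ E]
    [CompleteSpace E] {T : ℝ} (hT : 0 < T) {f : ℝ → E} (hf : ContDiffOn ℝ 1 f (Icc 0 T))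
    (h0 : f 0 = 0) {t : ℝ} (ht : t ∈ Icc 0 T) :
    f t = ∫ s in (0 : ℝ)..t, derivWithin f (Icc 0 T) s := by
  have hsub : Icc 0 t ⊆ Icc 0 T := Icc_subset_Icc_right ht.2
  rw [intervalIntegral.integral_eq_sub_of_hasDerivAt_of_le ht.1 (hf.continuousOn.mono hsub), h0,
    sub_zero]
  · intro s hs
    exact ((hf.differentiableOn one_ne_zero) s
      (hsub (Ioo_subset_Icc_self hs))).hasDerivWithinAt.hasDerivAt
      (Icc_mem_nhds hs.1 (hs.2.trans_le ht.2))
  · refine ContinuousOn.intervalIntegrable ?_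
    rw [uIcc_of_le ht.1]
    exact (hf.continuousOn_derivWithin (uniqueDiffOn_Icc hT) le_rfl).mono hsub

/-- A pointwise limit of `C¹` curves whose derivatives converge pointwise and boundedly to a
continuous function is a `C¹` curve with the limit as derivative. -/
theorem contDiffOn_of_tendsto_derivWithin {E : Type*} [NormedAddCommGroup E] [NormedSpace ℝ E]
    [CompleteSpace E] {T K : ℝ} (hT : 0 < T) {f : ℕ → ℝ → E} {f' g : ℝ → E}
    (hf : ∀ n, ContDiffOn ℝ 1 (f n) (Icc 0 T)) (h0 : ∀ n, f n 0 = 0)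
    (hK : ∀ n, ∀ t ∈ Icc 0 T, ‖derivWithin (f n) (Icc 0 T) t‖ ≤ K)
    (hg : ContinuousOn g (Icc 0 T))
    (hlim : ∀ t ∈ Icc 0 T, Tendsto (fun n => f n t) atTop (𝓝 (f' t)))
    (hlim' : ∀ t ∈ Icc 0 T, Tendsto (fun n => derivWithin (f n) (Icc 0 T) t) atTop (𝓝 (g t))) :
    ContDiffOn ℝ 1 f' (Icc 0 T) ∧ ∀ t ∈ Icc 0 T, derivWithin f' (Icc 0 T) t = g t := by
  have hsub : ∀ {t s}, t ∈ Icc 0 T → s ∈ uIoc 0 t → s ∈ Icc 0 T := fun ht hs =>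
    (sub_mem_Icc_of_mem_uIoc ht hs).1
  have hge : Continuous (IccExtend hT.le ((Icc 0 T).domRestrict g)) := hg.domRestrict.Icc_extend'
  set G := IccExtend hT.le ((Icc 0 T).domRestrict g) with hG
  have hGg : ∀ t ∈ Icc 0 T, G t = g t := fun t ht => IccExtend_of_mem hT.le _ ht
  -- The equation survives the limit in integrated form; its right-hand side is the primitive of a
  -- continuous function, hence C¹.
  have hf' : ∀ t ∈ Icc 0 T, f' t = ∫ s in (0 : ℝ)..t, G s := by
    intro t ht
    refine tendsto_nhds_unique (hlim t ht) ?_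
    simp only [fun n => eq_integral_derivWithin hT (hf n) (h0 n) ht]
    refine intervalIntegral.tendsto_integral_filter_of_dominated_convergence (fun _ => K)
      (Eventually.of_forall fun n => ?_) (Eventually.of_forall fun n => ae_of_all _ fun s hs =>
        hK n s (hsub ht hs)) intervalIntegrable_const (ae_of_all _ fun s hs => ?_)
    · exact (((hf n).continuousOn_derivWithin (uniqueDiffOn_Icc hT) le_rfl).mono
        fun s hs => hsub ht hs).aestronglyMeasurable measurableSet_uIoc
    · rw [hGg s (hsub ht hs)]
      exact hlim' s (hsub ht hs)
  have hder : ∀ t, HasDerivAt (fun t => ∫ s in (0 : ℝ)..t, G s) (G t) t := fun t =>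
    hge.integral_hasStrictDerivAt 0 t |>.hasDerivAt
  have hC1 : ContDiff ℝ 1 fun t => ∫ s in (0 : ℝ)..t, G s := by
    refine contDiff_one_iff_deriv.2 ⟨fun t => (hder t).differentiableAt, ?_⟩
    rwa [funext fun t => (hder t).deriv]
  refine ⟨hC1.contDiffOn.congr hf', fun t ht => ?_⟩
  rw [derivWithin_congr hf' (hf' t ht),
    (hder t).hasDerivWithinAt.derivWithin (uniqueDiffOn_Icc hT t ht), hGg t ht]

namespace ProblemData

variable {P : ProblemData}

/-! ### Feasible triples -/

theorem mem_admissible {w : ℝ → E3} (h : P.StateConstraint w) {t : ℝ} (ht : t ∈ Icc 0 P.T) :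
    w t + P.r₀ ∈ P.admissible := fun i => h i t ht

/-- The acceleration along a trajectory in the external field with potential `η`. -/
noncomputable def acceleration (P : ProblemData) (w z : ℝ → E3) (η : L2 P.Ω) (t : ℝ) : E3 :=
  P.force (w t + P.r₀) (z t + P.p₀)
    (P.field (fun s => w s + P.r₀) (fun s => z s + P.p₀) t) η

/-- Under the state constraint the system is an ordinary differential equation in which the control
enters only through its potential. -/
theorem feasible_iff (hP : P.StandingAssumptions) {w z : ℝ → E3} {u : L2Bdry P.Ω} :
    P.Feasible w z u ↔ P.MemC10 w ∧ P.MemC10 z ∧ P.StateConstraint w ∧ ∀ t ∈ Icc 0 P.T,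
      derivWithin z (Icc 0 P.T) t = P.acceleration w z (potential P.Ω u) t ∧
      derivWithin w (Icc 0 P.T) t = P.v (z t + P.p₀) := by
  constructor
  · rintro ⟨⟨hw, hz, h⟩, hc⟩
    refine ⟨hw, hz, hc, fun t ht => ?_⟩
    obtain ⟨h1, h2⟩ := h t ht
    rw [e₁_eq hP z u (mem_admissible hc ht)] at h1
    exact ⟨sub_eq_zero.1 h1, sub_eq_zero.1 h2⟩
  · rintro ⟨hw, hz, hc, h⟩
    refine ⟨⟨hw, hz, fun t ht => ?_⟩, hc⟩
    obtain ⟨h1, h2⟩ := h t ht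
    rw [e₁_eq hP z u (mem_admissible hc ht)]
    exact ⟨sub_eq_zero.2 h1, sub_eq_zero.2 h2⟩

theorem continuousOn_acceleration (hP : P.StandingAssumptions) {w z : ℝ → E3}
    (hw : ContinuousOn w (Icc 0 P.T)) (hz : ContinuousOn z (Icc 0 P.T)) (η : L2 P.Ω) :
    ContinuousOn (P.acceleration w z η) (Icc 0 P.T) := by
  have hw' : ContinuousOn (fun t => w t + P.r₀) (Icc 0 P.T) := hw.add continuousOn_const
  have hz' : ContinuousOn (fun t => z t + P.p₀) (Icc 0 P.T) := hz.add continuousOn_const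
  have h := (continuous_force hP η).comp_continuousOn
    (hw'.prodMk (hz'.prodMk (continuousOn_field hP hw' hz')))
  exact h

/-- The accelerations along trajectories with bounded controls are uniformly bounded. -/
theorem exists_bound_acceleration (hP : P.StandingAssumptions) (Cη : ℝ) :
    ∃ K, 0 ≤ K ∧ ∀ w z η, ‖η‖ ≤ Cη → ∀ t ∈ Icc 0 P.T, ‖P.acceleration w z η t‖ ≤ K := by
  obtain ⟨CV, -, hCV⟩ := exists_bound_field hP
  obtain ⟨K, hK0, hK⟩ := exists_bound_force hP CV Cη
  exact ⟨K, hK0, fun w z η hη t ht => hK _ _ _ _ (hCV _ _ t ht) hη⟩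

/-- Feasibility is preserved under pointwise convergence of the states and weak convergence of the
controls. -/
theorem feasible_of_tendsto (hP : P.StandingAssumptions) {w z : ℕ → ℝ → E3} {w' z' : ℝ → E3}
    {u : ℕ → L2Bdry P.Ω} {u' : L2Bdry P.Ω} {C : ℝ} (h : ∀ n, P.Feasible (w n) (z n) (u n))
    (hw' : Continuous w') (hz' : Continuous z')
    (hw : ∀ t ∈ Icc 0 P.T, Tendsto (fun n => w n t) atTop (𝓝 (w' t)))
    (hz : ∀ t ∈ Icc 0 P.T, Tendsto (fun n => z n t) atTop (𝓝 (z' t)))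
    (hC : ∀ n, ‖u n‖ ≤ C)
    (hu : ∀ y, Tendsto (fun n => inner ℝ (u n) y) atTop (𝓝 (inner ℝ u' y))) :
    P.Feasible w' z' u' := by
  have := hP.isFiniteMeasure_volume
  have := hP.isFiniteMeasure_surface
  obtain ⟨Λ, hΛ⟩ := exists_potential_eq hP.isOpen hP.poissonRegular
  have h' := fun n => (feasible_iff hP).1 (h n)
  have hC' : ∀ n, ‖potential P.Ω (u n)‖ ≤ ‖Λ‖ * C := fun n => by
    rw [hΛ]
    exact (Λ.le_opNorm _).trans (mul_le_mul_of_nonneg_left (hC n) (norm_nonneg _))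
  have hη : ∀ y, Tendsto (fun n => inner ℝ (potential P.Ω (u n)) y) atTop
      (𝓝 (inner ℝ (potential P.Ω u') y)) := fun y => by
    -- Pairing `Λ u` with `y` is pairing `u` with the adjoint applied to `y`, so weak convergence is
    -- inherited.
    simp only [hΛ, ← ContinuousLinearMap.adjoint_inner_right]
    exact hu _
  obtain ⟨K, -, hK⟩ := exists_bound_acceleration hP (‖Λ‖ * C)
  have h0 : (0 : ℝ) ∈ Icc 0 P.T := ⟨le_rfl, hP.T_pos.le⟩
  have hz0 : z' 0 = 0 := by
    refine tendsto_nhds_unique (hz 0 h0) ?_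
    simp only [fun n => (h' n).2.1.2]
    exact tendsto_const_nhds
  have hw0 : w' 0 = 0 := by
    refine tendsto_nhds_unique (hw 0 h0) ?_
    simp only [fun n => (h' n).1.2]
    exact tendsto_const_nhds
  have hwc : ∀ n, ContinuousOn (w n) (Icc 0 P.T) := fun n => (h' n).1.1.continuousOn
  have hzc : ∀ n, ContinuousOn (z n) (Icc 0 P.T) := fun n => (h' n).2.1.1.continuousOn
  have hv := continuous_v hP
  obtain ⟨hz1, hz2⟩ := contDiffOn_of_tendsto_derivWithin hP.T_pos (fun n => (h' n).2.1.1)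
    (fun n => (h' n).2.1.2) (K := K) (g := P.acceleration w' z' (potential P.Ω u'))
    (fun n t ht => by
      rw [((h' n).2.2.2 t ht).1]
      exact hK _ _ _ (hC' n) t ht)
    (continuousOn_acceleration hP hw'.continuousOn hz'.continuousOn _) hz (fun t ht => by
      simp only [fun n => ((h' n).2.2.2 t ht).1]
      refine tendsto_force hP ((hw t ht).add_const _) ((hz t ht).add_const _) ?_ hC' hη
      exact tendsto_field hP (fun n => (hwc n).add continuousOn_const)
        (fun n => (hzc n).add continuousOn_const) (fun s hs => (hw s hs).add_const _)
        (fun s hs => (hz s hs).add_const _) ht)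
  obtain ⟨hw1, hw2⟩ := contDiffOn_of_tendsto_derivWithin hP.T_pos (fun n => (h' n).1.1)
    (fun n => (h' n).1.2) (K := P.c) (g := fun t => P.v (z' t + P.p₀))
    (fun n t ht => by
      rw [((h' n).2.2.2 t ht).2]
      exact norm_v_le hP _)
    (by fun_prop) hw (fun t ht => by
      simp only [fun n => ((h' n).2.2.2 t ht).2]
      exact (hv.tendsto _).comp ((hz t ht).add_const _))
  refine (feasible_iff hP).2 ⟨⟨hw1, hw0⟩, ⟨hz1, hz0⟩, fun i t ht => ?_, fun t ht =>
    ⟨hz2 t ht, hw2 t ht⟩⟩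
  exact le_of_tendsto (((hP.g_contDiff i).continuous.tendsto _).comp ((hw t ht).add_const _))
    (Eventually.of_forall fun n => (h' n).2.2.1 i t ht)

/-- Feasible triples with bounded controls have a subsequence converging to a feasible triple. -/
theorem exists_convergent_subseq_of_feasible (hP : P.StandingAssumptions) {w z : ℕ → ℝ → E3}
    {u : ℕ → L2Bdry P.Ω} {C : ℝ} (h : ∀ n, P.Feasible (w n) (z n) (u n)) (hC : ∀ n, ‖u n‖ ≤ C) :
    ∃ (w' z' : ℝ → E3) (u' : L2Bdry P.Ω) (k : ℕ → ℕ), P.Feasible w' z' u' ∧ StrictMono k ∧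
      (∀ t ∈ Icc 0 P.T, Tendsto (fun n => w (k n) t) atTop (𝓝 (w' t))) ∧
      ∀ y, Tendsto (fun n => inner ℝ (u (k n)) y) atTop (𝓝 (inner ℝ u' y)) := by
  have := hP.isFiniteMeasure_volume
  have := hP.isFiniteMeasure_surface
  obtain ⟨Λ, hΛ⟩ := exists_potential_eq hP.isOpen hP.poissonRegular
  have h' := fun n => (feasible_iff hP).1 (h n)
  have hC' : ∀ n, ‖potential P.Ω (u n)‖ ≤ ‖Λ‖ * C := fun n => by
    rw [hΛ]
    exact (Λ.le_opNorm _).trans (mul_le_mul_of_nonneg_left (hC n) (norm_nonneg _))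
  obtain ⟨K, hK0, hK⟩ := exists_bound_acceleration hP (‖Λ‖ * C)
  have hwL : ∀ n, LipschitzOnWith P.c.toNNReal (w n) (Icc 0 P.T) := fun n =>
    (convex_Icc 0 P.T).lipschitzOnWith_of_nnnorm_derivWithin_le
      ((h' n).1.1.differentiableOn one_ne_zero) fun t ht => by
        rw [((h' n).2.2.2 t ht).2, ← NNReal.coe_le_coe, Real.coe_toNNReal _ hP.c_pos.le]
        exact norm_v_le hP _
  have hzL : ∀ n, LipschitzOnWith K.toNNReal (z n) (Icc 0 P.T) := fun n =>
    (convex_Icc 0 P.T).lipschitzOnWith_of_nnnorm_derivWithin_le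
      ((h' n).2.1.1.differentiableOn one_ne_zero) fun t ht => by
        rw [((h' n).2.2.2 t ht).1, ← NNReal.coe_le_coe, Real.coe_toNNReal _ hK0]
        exact hK _ _ _ (hC' n) t ht
  -- Needed for the separability of L²(Γ).
  have : Fact ((2 : ENNReal) ≠ ⊤) := ⟨ENNReal.ofNat_ne_top⟩
  obtain ⟨u', k₁, hk₁, hu'⟩ := exists_weakly_convergent_subseq u C hC
  -- Pairing position and momentum yields one subsequence for both; the product carries the maximum
  -- norm, whence the maximum of the constants.
  obtain ⟨y, k₂, hy, hk₂, hlim⟩ := exists_convergent_subseq_of_lipschitzOn hP.T_pos.le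
    (fun n t => (w (k₁ n) t, z (k₁ n) t)) (max P.c.toNNReal K.toNNReal)
    (fun n => (hwL (k₁ n)).prodMk (hzL (k₁ n)))
    (fun n => by simp [(h' (k₁ n)).1.2, (h' (k₁ n)).2.1.2])
  have hw := fun t ht => (hlim t ht).fst_nhds
  have hz := fun t ht => (hlim t ht).snd_nhds
  have hu := fun y => (hu' y).comp hk₂.tendsto_atTop
  exact ⟨fun t => (y t).1, fun t => (y t).2, u', k₁ ∘ k₂,
    feasible_of_tendsto hP (fun n => h (k₁ (k₂ n))) (by fun_prop) (by fun_prop) hw hz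
      (fun n => hC _) hu, hk₁.comp hk₂, hw, hu⟩

/-! ### The objective -/

theorem objective_eq (r : ℝ → E3) (u : L2Bdry P.Ω) : P.objective r u =
    (∫ t in (0 : ℝ)..P.T, P.J₁ (r t)) + P.J₂ (r P.T) + P.α / 2 * ‖u‖ ^ 2 := by
  rw [objective, ← real_inner_self_eq_norm_sq, ← integral_mul_eq_inner]
  simp only [sq]

/-- A lower bound of the objective which is coercive in the control. -/
theorem exists_coercive_bound (hP : P.StandingAssumptions) :
    ∃ b : ℝ, ∀ w z u, P.Feasible w z u →
      b + P.α / 2 * ‖u‖ ^ 2 ≤ P.objective (fun t => w t + P.r₀) u := by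
  obtain ⟨c₁, hc₁⟩ := hP.J₁_bddBelow
  obtain ⟨c₂, hc₂⟩ := hP.J₂_bddBelow
  refine ⟨c₁ * P.T + c₂, fun w z u h => ?_⟩
  have hw : ContinuousOn w (Icc 0 P.T) := h.1.1.1.continuousOn
  have hint : IntervalIntegrable (fun t => P.J₁ (w t + P.r₀)) volume 0 P.T := by
    refine ContinuousOn.intervalIntegrable ?_
    rw [uIcc_of_le hP.T_pos.le]
    exact hP.J₁_contDiff.continuous.comp_continuousOn (hw.add continuousOn_const)
  have h1 : c₁ * P.T ≤ ∫ t in (0 : ℝ)..P.T, P.J₁ (w t + P.r₀) := by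
    have := intervalIntegral.integral_mono_on hP.T_pos.le
      (intervalIntegrable_const (c := c₁)) hint fun t _ => hc₁ _
    simpa [mul_comm] using this
  rw [objective_eq]
  linarith [hc₂ (w P.T + P.r₀)]

/-- The objective is lower semicontinuous along convergent sequences of feasible triples. -/
theorem objective_le_of_tendsto (hP : P.StandingAssumptions) {w z : ℕ → ℝ → E3} {w' : ℝ → E3}
    {u : ℕ → L2Bdry P.Ω} {u' : L2Bdry P.Ω} {I : ℝ} (h : ∀ n, P.Feasible (w n) (z n) (u n))
    (hw : ∀ t ∈ Icc 0 P.T, Tendsto (fun n => w n t) atTop (𝓝 (w' t)))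
    (hu : ∀ y, Tendsto (fun n => inner ℝ (u n) y) atTop (𝓝 (inner ℝ u' y)))
    (hI : Tendsto (fun n => P.objective (fun t => w n t + P.r₀) (u n)) atTop (𝓝 I)) :
    P.objective (fun t => w' t + P.r₀) u' ≤ I := by
  have hJ₁ := hP.J₁_contDiff.continuous
  have hT : P.T ∈ Icc 0 P.T := ⟨hP.T_pos.le, le_rfl⟩
  have hmem : ∀ {t}, t ∈ uIoc 0 P.T → t ∈ Icc 0 P.T := fun ht =>
    (sub_mem_Icc_of_mem_uIoc hT ht).1
  -- Feasible positions stay in a fixed bounded set, on which the continuous `J₁` is bounded; this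
  -- bound dominates the running cost.
  have hbd : Bornology.IsBounded P.admissible := hP.isBounded.subset hP.admissible_subset
  obtain ⟨B, hB⟩ := hbd.isCompact_closure.exists_bound_of_continuousOn hJ₁.continuousOn
  have h1 : Tendsto (fun n => ∫ t in (0 : ℝ)..P.T, P.J₁ (w n t + P.r₀)) atTop
      (𝓝 (∫ t in (0 : ℝ)..P.T, P.J₁ (w' t + P.r₀))) := by
    refine intervalIntegral.tendsto_integral_filter_of_dominated_convergence (fun _ => B)
      (Eventually.of_forall fun n => ?_) (Eventually.of_forall fun n => ae_of_all _ fun t ht =>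
        hB _ (subset_closure (mem_admissible (h n).2 (hmem ht)))) intervalIntegrable_const
      (ae_of_all _ fun t ht => (hJ₁.tendsto _).comp ((hw t (hmem ht)).add_const _))
    have hwn : ContinuousOn (w n) (uIoc 0 P.T) := (h n).1.1.1.continuousOn.mono fun t => hmem
    exact (hJ₁.comp_continuousOn (hwn.add continuousOn_const)).aestronglyMeasurable
      measurableSet_uIoc
  have h2 : Tendsto (fun n => P.J₂ (w n P.T + P.r₀)) atTop (𝓝 (P.J₂ (w' P.T + P.r₀))) :=
    (hP.J₂_contDiff.continuous.tendsto _).comp ((hw _ hT).add_const _)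
  -- Since `‖u n - u'‖ ^ 2 ≥ 0`, the squared norm of `u n` is at least `2⟪u n, u'⟫ - ‖u'‖ ^ 2`,
  -- which converges to `‖u'‖ ^ 2`.
  have h3 := (((hu u').const_mul 2).sub_const (‖u'‖ ^ 2)).const_mul (P.α / 2)
  have h4 := le_of_tendsto_of_tendsto' ((h1.add h2).add h3) hI fun n => by
    rw [objective_eq]
    have hα := hP.α_pos
    have := norm_sub_sq_real (u n) u'
    gcongr
    nlinarith [sq_nonneg ‖u n - u'‖]
  rw [objective_eq]
  rw [real_inner_self_eq_norm_sq] at h4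
  linarith

end ProblemData

end AbrahamControl

/-! ### Existence of an optimal control by the direct method -/

theorem mainTheorem2 (P : AbrahamControl.ProblemData) (hP : P.StandingAssumptions)
    (hfeas : ∃ (u : AbrahamControl.L2Bdry P.Ω) (w z : ℝ → AbrahamControl.E3),
      P.IsState w z u ∧ P.StateConstraint w) :
    ∃ u : AbrahamControl.L2Bdry P.Ω, P.IsOptimalControl u := by
  obtain ⟨b, hb⟩ := AbrahamControl.ProblemData.exists_coercive_bound hP
  have hα := hP.α_pos
  let S : Set ℝ := {y | ∃ w z u, P.Feasible w z u ∧ y = P.objective (fun t => w t + P.r₀) u}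
  have hne : S.Nonempty := by
    obtain ⟨u, w, z, h⟩ := hfeas
    exact ⟨_, w, z, u, h, rfl⟩
  have hbdd : BddBelow S := by
    refine ⟨b, ?_⟩
    rintro _ ⟨w, z, u, h, rfl⟩
    refine le_trans ?_ (hb w z u h)
    linarith [mul_nonneg (half_pos hα).le (sq_nonneg ‖u‖)]
  obtain ⟨y, -, hy, hyS⟩ := exists_seq_tendsto_sInf hne hbdd
  choose w z u hfe hyeq using hyS
  obtain ⟨B, hB⟩ := hy.bddAbove_range
  -- The radius solves `b + α / 2 * ‖u‖ ^ 2 ≤ B` for `‖u‖`, where `B` bounds the convergent sequence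
  -- of objective values.
  have hC : ∀ n, ‖u n‖ ≤ √(2 / P.α * (B - b)) := by
    intro n
    refine Real.le_sqrt_of_sq_le ?_
    have h1 := hb _ _ _ (hfe n)
    rw [← hyeq n] at h1
    have h2 : y n ≤ B := hB (mem_range_self n)
    rw [div_mul_eq_mul_div, le_div_iff₀ hα]
    linarith
  obtain ⟨w', z', u', k, hfe', hk, hw, hu⟩ :=
    AbrahamControl.ProblemData.exists_convergent_subseq_of_feasible hP hfe hC
  refine ⟨u', w', z', hfe', fun w₁ z₁ u₁ h₁ => ?_⟩
  refine (AbrahamControl.ProblemData.objective_le_of_tendsto hP (fun n => hfe (k n))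
    hw hu ?_).trans (csInf_le hbdd ⟨w₁, z₁, u₁, h₁, rfl⟩)
  simp only [← hyeq]
  exact hy.comp hk.tendsto_atTop
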